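/- **Setting.** Let $\Omega\subset\mathbb R^2$ be a polygonal domain, that is, a nonempty connected set which is the interior of a finite union of convex polygons. Let $V\in C^1(\overline\Omega)$, and let $u_0\in L^2(\Omega)$, $u_0\ge 0$, have positive mass $M_1=\int_\Omega u_0>0$. An admissible mesh of $\Omega$ consists of finitely many pairwise disjoint open convex polygonal cells $K\in\mathcal T$, $K\subset\Omega$, whose closures cover $\overline\Omega$, finitely many non-overlapping edges $\sigma\in\mathcal E$ (segments of positive length), and centers $x_K\in K$, such that: every $\partial K$ is the union of a set $\mathcal E_K$ of edges and $\mathcal E=\bigcup_K\mathcal E_K$; for $K\ne L$ either $\overline K\cap\overline L$ has zero length or it is an edge, denoted $\sigma=K|L$, and in the latter case the line through $x_K,x_L$ is orthogonal to $\sigma$; and for an edge $\sigma\in\mathcal E_K$ contained in $\partial\Omega$, the line through $x_K$ orthogonal to $\sigma$ meets $\sigma$. Let $m_K$ be the area of $K$, $m_\sigma$ the length of $\sigma$, $d(x_K,\sigma)$ the distance from $x_K$ to the line containing $\sigma$, $d_\sigma=|x_K-x_L|$ if $\sigma=K|L$, $d_\sigma=d(x_K,\sigma)$ if $\sigma\in\mathcal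 E_K$ is a boundary edge, and $\tau_\sigma=m_\sigma/d_\sigma$. The mesh has regularity $\zeta>0$ if $d(x_K,\sigma)\ge\zeta d_\sigma$ for all $K\in\mathcal T$ and $\sigma\in\mathcal E_K$. Put $V_K=V(x_K)$. Let $r:(0,\infty)^2\to(0,\infty)$ be symmetric, nondecreasing in both variables, homogeneous of degree one, with $r(x,x)=x$ and $\frac{x-y}{\log x-\log y}\le r(x,y)\le\max(x,y)$ for $x\neq y$. For a time step $\Delta t>0$ and $t^n=n\Delta t$, a solution of the nonlinear TPFA scheme with no-flux boundary conditions is a sequence $(u_K^n)_{K\in\mathcal T,\,n\ge0}$ with $u_K^0=\frac1{m_K}\int_K u_0$, $u_K^{n+1}>0$, and for all $K\in\mathcal T$, $n\ge 0$, $$m_K\frac{u_K^{n+1}-u_K^n}{\Delta t}-\sum_{\sigma=K|L\in\mathcal E_K}\tau_\sigma\, r(u_K^{n+1},u_L^{n+1})\bigl(\log u_L^{n+1}+V_L-\log u_K^{n+1}-V_K\bigr)=0 .$$ The Gibbs steady state is $u_K^\infty=\rho e^{-V_K}$ with $\rho=M_1\bigl(\sum_{L}m_Le^{-V_L}\bigr)^{-1}$.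 Put $\Phi_1(s)=s\log s-s+1$ (with $0\log 0=0$), $\Phi_p(s)=\frac{s^p-ps}{p-1}+1$ for $p\in(1,2]$, and $\mathbb E_p^n=\sum_K m_Ku_K^\infty\Phi_p(u_K^n/u_K^\infty)$. **Theorem.** For every $p\in[1,2]$ there is $\nu_p>0$, depending only on $p$, $\Omega$, $\zeta$, $V$ and, if $p=1$, on $M_1$, such that for every admissible mesh of regularity $\zeta$, every $r$, $u_0$, $\Delta t$ as above and every solution of the scheme, $$\mathbb E_p^n\le(1+\nu_p\Delta t)^{-n}\,\mathbb E_p^0\qquad\text{for all } n\ge0 .$$ Moreover, for every $k>0$ with $\Delta t\le k$, one has $\mathbb E_p^n\le e^{-\tilde\nu_pt^n}\mathbb E_p^0$ for all $n\ge0$, where $\tilde\nu_p=\log(1+\nu_pk)/k$. The rate is explicit: there are constants $C_{LS},C_B>0$ depending only on $\Omega$ such that, whenever $0<m^\infty\le u_K^\infty\le M^\infty$ for all $K\in\mathcal T$, both estimates hold with $$\nu_1=\frac{\zeta^2}{C_{LS}}\,\frac{m^\infty}{(M^\infty M_1)^{1/2}},\qquad \nu_p=(p-1)\,\frac{\zeta}{C_B}\,\frac{m^\infty}{M^\infty}\quad(1<p\le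 2).$$ -/

import Mathlib

open MeasureTheory Set
open scoped BigOperators

noncomputable section

/-- The Euclidean plane. -/
abbrev Plane : Type := EuclideanSpace ℝ (Fin 2)

/-- A polygonal domain: a nonempty connected set that is the interior of a finite union of
convex polygons (convex hulls of finite sets of points). Such a set is open and bounded, and it
lies locally on one side of each side of its boundary (there are no slits or punctures). -/
structure IsPolygonalDomain (Ω : Set Plane) : Prop where
  polygonal : ∃ F : Finset (Finset Plane), Ω = interior (⋃ s ∈ F, convexHull ℝ (s : Set Plane))
  connected : IsConnected Ω

/-- `V ∈ C¹(closure Ω)`: `V` is continuous on the closure, continuously differentiable in `Ω`, and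
its derivative extends continuously to the closure. -/
structure IsC1UpToBoundary (Ω : Set Plane) (V : Plane → ℝ) : Prop where
  continuousOn : ContinuousOn V (closure Ω)
  contDiffOn : ContDiffOn ℝ 1 V Ω
  deriv_extends : ∃ G : Plane → (Plane →L[ℝ] ℝ),
    ContinuousOn G (closure Ω) ∧ EqOn (fderiv ℝ V) G Ω

/-- An admissible finite volume mesh of `Ω`, with cells indexed by `T` and edges indexed by `E`.
The edge `σ` is the closed segment with end points `fst σ` and `snd σ`; the edges of a cell are
those that are contained in its boundary. -/
structure AdmissibleMesh (Ω : Set Plane) (T E : Type) where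
  /-- the control volumes -/
  cell : T → Set Plane
  /-- the cell centers `x_K` -/
  center : T → Plane
  /-- first end point of an edge -/
  fst : E → Plane
  /-- second end point of an edge -/
  snd : E → Plane
  /-- control volumes are open convex polygons -/
  cell_polygon : ∀ K, ∃ s : Finset Plane, cell K = interior (convexHull ℝ (s : Set Plane))
  cell_subset : ∀ K, cell K ⊆ Ω
  cell_disjoint : ∀ K L, K ≠ L → Disjoint (cell K) (cell L)
  closure_iUnion_cell : closure (⋃ K, cell K) = closure Ω
  /-- edges have positive length -/
  fst_ne_snd : ∀ σ, fst σ ≠ snd σ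
  /-- distinct edges do not overlap (they share at most one point) -/
  edge_inter : ∀ σ σ', σ ≠ σ' →
    (segment ℝ (fst σ) (snd σ) ∩ segment ℝ (fst σ') (snd σ')).Subsingleton
  /-- the boundary of a cell is the union of its edges -/
  frontier_cell : ∀ K, frontier (cell K) =
    ⋃ σ ∈ {σ : E | segment ℝ (fst σ) (snd σ) ⊆ frontier (cell K)}, segment ℝ (fst σ) (snd σ)
  /-- every edge is an edge of some cell -/
  exists_cell : ∀ σ, ∃ K, segment ℝ (fst σ) (snd σ) ⊆ frontier (cell K)
  /-- The closures of two cells either have an intersection of zero length (being convex, it is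
  then empty or a point), or they meet exactly along an edge. -/
  inter_cells : ∀ K L, K ≠ L → (closure (cell K) ∩ closure (cell L)).Subsingleton ∨
    ∃ σ, closure (cell K) ∩ closure (cell L) = segment ℝ (fst σ) (snd σ)
  center_mem : ∀ K, center K ∈ cell K
  /-- the line through the centers of two neighbouring cells is orthogonal to their edge -/
  orthogonal : ∀ K L σ, K ≠ L →
    closure (cell K) ∩ closure (cell L) = segment ℝ (fst σ) (snd σ) →
      inner ℝ (center L - center K) (snd σ - fst σ) = 0
  /-- for an edge on the boundary of the domain, the line through the center that is orthogonal to
  the edge meets the edge -/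
  orthogonal_boundary : ∀ K σ, segment ℝ (fst σ) (snd σ) ⊆ frontier (cell K) →
    segment ℝ (fst σ) (snd σ) ⊆ frontier Ω →
      ∃ y ∈ segment ℝ (fst σ) (snd σ), inner ℝ (y - center K) (snd σ - fst σ) = 0

namespace AdmissibleMesh

variable {Ω : Set Plane} {T E : Type} (𝔐 : AdmissibleMesh Ω T E)

/-- The edge `σ`, as a closed segment. -/
def edge (σ : E) : Set Plane := segment ℝ (𝔐.fst σ) (𝔐.snd σ)

open Classical in
/-- `𝓔_K`, the set of the edges of the cell `K`. -/
def edges [Fintype E] (K : T) : Finset E :=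
  Finset.univ.filter fun σ => 𝔐.edge σ ⊆ frontier (𝔐.cell K)

/-- `σ = K|L` is the common edge of the two distinct cells `K` and `L`. -/
def IsInterface (K L : T) (σ : E) : Prop :=
  K ≠ L ∧ closure (𝔐.cell K) ∩ closure (𝔐.cell L) = 𝔐.edge σ

open Classical in
/-- The cell `L` on the other side of `σ`, if `σ = K|L` is an interior edge of `K`. If `σ` is a
boundary edge of `K`, this is `K` itself, so that `u (nb K σ)` is the value `u_{K,σ}` which
encodes the no-flux condition. -/
def nb (K : T) (σ : E) : T := if h : ∃ L, 𝔐.IsInterface K L σ then h.choose else K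

/-- `m_K`, the area of the cell `K`. -/
def area (K : T) : ℝ := (volume (𝔐.cell K)).toReal

/-- `m_σ`, the length of the edge `σ`. -/
def length (σ : E) : ℝ := dist (𝔐.fst σ) (𝔐.snd σ)

/-- `d(x_K, σ)`, the distance from the center of `K` to the line that contains `σ`. -/
def distEdge (K : T) (σ : E) : ℝ :=
  Metric.infDist (𝔐.center K) (line[ℝ, 𝔐.fst σ, 𝔐.snd σ] : Set Plane)

open Classical in
/-- `d_σ`, for an edge `σ` of `K`: it is `d(x_K, x_L)` if `σ = K|L` is an interior edge (the same
value for `K` and for `L`), and `d(x_K, σ)` if `σ` is a boundary edge. -/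
def dEdge (K : T) (σ : E) : ℝ :=
  if ∃ L, 𝔐.IsInterface K L σ then dist (𝔐.center K) (𝔐.center (𝔐.nb K σ)) else 𝔐.distEdge K σ

/-- The transmissibility `τ_σ = m_σ / d_σ`, for an edge `σ` of `K`. -/
def trans (K : T) (σ : E) : ℝ := 𝔐.length σ / 𝔐.dEdge K σ

/-- The regularity constraint on the mesh: `d(x_K, σ) ≥ ζ d_σ` for all `K` and `σ ∈ 𝓔_K`. -/
def IsRegular [Fintype E] (ζ : ℝ) : Prop :=
  ∀ K, ∀ σ ∈ 𝔐.edges K, ζ * 𝔐.dEdge K σ ≤ 𝔐.distEdge K σ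

end AdmissibleMesh

/-- The admissible mean functions `r : (0,∞)² → (0,∞)` used for the edge values of the density. -/
structure IsMeanFunction (r : ℝ → ℝ → ℝ) : Prop where
  pos : ∀ x y, 0 < x → 0 < y → 0 < r x y
  mono : ∀ x x' y y', 0 < x → 0 < y → x ≤ x' → y ≤ y' → r x y ≤ r x' y'
  diag : ∀ x, 0 < x → r x x = x
  symm : ∀ x y, 0 < x → 0 < y → r x y = r y x
  homog : ∀ c x y, 0 < c → 0 < x → 0 < y → r (c * x) (c * y) = c * r x y
  lower : ∀ x y, 0 < x → 0 < y → x ≠ y → (x - y) / (Real.log x - Real.log y) ≤ r x y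
  upper : ∀ x y, 0 < x → 0 < y → x ≠ y → r x y ≤ max x y

/-- Assumptions on the initial datum: square integrable, non-negative, of positive mass. -/
structure IsInitialDatum (Ω : Set Plane) (u₀ : Plane → ℝ) : Prop where
  memLp : MemLp u₀ 2 (volume.restrict Ω)
  nonneg : ∀ᵐ x ∂(volume.restrict Ω), 0 ≤ u₀ x
  mass_pos : 0 < ∫ x in Ω, u₀ x

section Scheme

variable {Ω : Set Plane} {T E : Type} [Fintype T] [Fintype E]

/-- The numerical flux `-τ_σ r(w_K, w_{K,σ}) D_{K,σ}(log w + V)` through an edge `σ` of `K`; it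
vanishes on boundary edges (no-flux condition). -/
def flux (𝔐 : AdmissibleMesh Ω T E) (r : ℝ → ℝ → ℝ) (V : Plane → ℝ) (w : T → ℝ) (K : T) (σ : E) :
    ℝ :=
  -(𝔐.trans K σ) * r (w K) (w (𝔐.nb K σ)) *
    ((Real.log (w (𝔐.nb K σ)) + V (𝔐.center (𝔐.nb K σ))) - (Real.log (w K) + V (𝔐.center K)))

/-- `u` is a (positive) solution of the nonlinear two-point flux scheme with no-flux boundary
conditions. The initial values are the cell averages of `u₀` (they may vanish); the values at later
times are positive. -/
structure IsSolution (𝔐 : AdmissibleMesh Ω T E) (r : ℝ → ℝ → ℝ) (V u₀ : Plane → ℝ) (Δt : ℝ)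
    (u : ℕ → T → ℝ) : Prop where
  init : ∀ K, u 0 K = (1 / 𝔐.area K) * ∫ x in 𝔐.cell K, u₀ x
  pos : ∀ n K, 0 < u (n + 1) K
  scheme : ∀ n K, 𝔐.area K * ((u (n + 1) K - u n K) / Δt)
    + ∑ σ ∈ 𝔐.edges K, flux 𝔐 r V (u (n + 1)) K σ = 0

/-- The discrete Gibbs steady state `u_K^∞ = ρ exp(-V_K)` of mass `M = ∑_K m_K u_K^∞`. -/
def steadyState (𝔐 : AdmissibleMesh Ω T E) (V : Plane → ℝ) (M : ℝ) (K : T) : ℝ :=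
  (M / ∑ L, 𝔐.area L * Real.exp (-V (𝔐.center L))) * Real.exp (-V (𝔐.center K))

open Classical in
/-- `Φ₁(s) = s log s - s + 1` (with `0 log 0 = 0`) and `Φ_p(s) = (s^p - p s)/(p - 1) + 1` for
`p ≠ 1`. -/
def Phi (p s : ℝ) : ℝ :=
  if p = 1 then s * Real.log s - s + 1 else (s ^ p - p * s) / (p - 1) + 1

/-- The relative entropy `∑_K m_K u_K^∞ Φ_p(w_K / u_K^∞)` with respect to the Gibbs steady state
of mass `M`. -/
def relEntropy (𝔐 : AdmissibleMesh Ω T E) (V : Plane → ℝ) (M p : ℝ) (w : T → ℝ) : ℝ :=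
  ∑ K, 𝔐.area K * steadyState 𝔐 V M K * Phi p (w K / steadyState 𝔐 V M K)

end Scheme

/-- Decay of a sequence `e` at the rate `ν` for the time step `Δt`:
`e n ≤ (1 + ν Δt)^(-n) e 0` for all `n` and, for all `k > 0` with `Δt ≤ k`,
`e n ≤ exp(-ν' t^n) e 0` for all `n`, where `ν' = log (1 + ν k) / k` and `t^n = n Δt`. -/
def DecaysAtRate (e : ℕ → ℝ) (Δt ν : ℝ) : Prop :=
  (∀ n : ℕ, e n ≤ (1 + ν * Δt) ^ (-(n : ℤ)) * e 0) ∧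
  ∀ k : ℝ, 0 < k → Δt ≤ k →
    ∀ n : ℕ, e n ≤ Real.exp (-(Real.log (1 + ν * k) / k) * (n * Δt)) * e 0

open Classical in
/-- The explicit rate: `ζ² / C_LS * m / √(M M₁)` for `p = 1` and `(p - 1) ζ / C_B * m / M` for
`p ≠ 1`, where `m` and `M` are bounds of the steady state and `M₁` is the mass. -/
def explicitRate (C_LS C_B ζ m M M₁ p : ℝ) : ℝ :=
  if p = 1 then ζ ^ 2 / C_LS * (m / Real.sqrt (M * M₁)) else (p - 1) * (ζ / C_B) * (m / M)

end

/-!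
The entropy is a convex function of the density, so the implicit Euler step gives
`E^{n+1} + Δt * (dissipation at time n + 1) ≤ E^n`, and the decay follows once the dissipation
dominates a multiple of the entropy. With `v = u / u^∞` and `f = v ^ (p / 2)`, elementary
inequalities for the mean function `r` and for `Φ_p` bound the dissipation from below by
`m^∞ * ∑ τ_σ (f_K - f_L)²` (`mul_dirichlet_le_sum_flux`) and the entropy from above by
`M^∞ / (p - 1) * ∑ m_K (f_K - c)²`, for `p > 1` (`sum_Phi_le_sum_sq`), or, for `p = 1`, by a
multiple of `(M^∞ M₁)^{1/2} * (∑ m_K (f_K - c)⁴)^{1/2}` (`sum_Phi_one_le`), for any constant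
`c > 0`. The freedom to choose `c` comes from the variational characterization of the entropy, for
which the masses of `u` and `u^∞` have to agree. What is left is the discrete Poincaré and Sobolev
inequality `IsPolygonalDomain.exists_discrete_sobolev`, whose constant depends on the mesh only
through its regularity `ζ`.

This inequality follows from the BV Poincaré-Sobolev inequality
`∑ m_K m_L (w_K - w_L)² ≤ C * (∑ ℓ_KL |w_K - w_L|)²` (`IsPolygonalDomain.linked_self`), where `ℓ_KL`
is the length of the interface of `K` and `L`. It is applied to the signed square
`w = (f - c) |f - c|`, where `c` is such that `w` has mean zero: by the Cauchy-Schwarz inequality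
the total variation of `w` is controlled by the Dirichlet form and by `∑ m_σ d_σ (f_K - c)²`, which
is at most a multiple of `ζ⁻¹ ∑ m_K (f_K - c)²`, since the triangles with vertex `x_K` over the
edges of `K` do not overlap (`sum_length_mul_distEdge_le`).

The BV inequality is proved on a parallelogram first, with the paths that join two points by one
segment in each of the two directions. A connected path inside `Ω` runs through a chain of cells
with intersecting closures, so the difference of two values of `w` is at most the sum of the jumps
over the interfaces hit by the path; on a segment this depends on one coordinate only, and the
product of the bounds for the two paths through opposite corners can be integrated
(`exists_crossVariance_parallelogram_le`). A polygonal domain is, up to a null set, a finite union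
of parallelograms contained in it, because a triangle is the union of three parallelograms, and the
inequalities on two overlapping parallelograms can be combined; connectedness links any two of
them.
-/

/-! ### Step functions on partitions and chains of cells -/

theorem SimpleGraph.Walk.IsPath.abs_sub_le {T : Type*} [Fintype T] {G : SimpleGraph T} (w : T → ℝ)
    (g : T → T → ℝ) (hg : ∀ K L, 0 ≤ g K L) (hadj : ∀ K L, G.Adj K L → |w K - w L| ≤ g K L)
    {a b : T} (p : G.Walk a b) (hp : p.IsPath) : |w a - w b| ≤ ∑ K, ∑ L, g K L := by
  classical
  have key : |w a - w b| ≤ ∑ K ∈ p.support.toFinset, ∑ L, g K L := by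
    induction p with
    | nil => simpa using Finset.sum_nonneg fun L _ => hg _ L
    | @cons a c b h q ih =>
      rw [SimpleGraph.Walk.cons_isPath_iff] at hp
      rw [SimpleGraph.Walk.support_cons, List.toFinset_cons, Finset.sum_insert (by simpa using hp.2)]
      have h1 : g a c ≤ ∑ L, g a L :=
        Finset.single_le_sum (f := fun L => g a L) (fun L _ => hg _ L) (Finset.mem_univ c)
      linarith [ih hp.1, hadj a c h, _root_.abs_sub_le (w a) (w c) (w b)]
  exact key.trans (Finset.sum_le_sum_of_subset_of_nonneg (Finset.subset_univ _)
    fun K _ _ => Finset.sum_nonneg fun L _ => hg K L)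

open Classical in
/-- On a connected set which is covered by finitely many closed sets `F K`, two values of `w` differ
by at most the sum of the jumps of `w` over the pairs of sets which meet on `S`: the nerve of the
cover of `S` is a connected graph, and a path in it uses no pair twice. -/
theorem abs_sub_le_sum_of_isPreconnected {X T : Type*} [TopologicalSpace X] [Fintype T]
    {F : T → Set X} (hF : ∀ K, IsClosed (F K)) {S : Set X} (hS : IsPreconnected S)
    (hcov : S ⊆ ⋃ K, F K) (w : T → ℝ) {K L : T} {x y : X} (hxS : x ∈ S) (hx : x ∈ F K)
    (hyS : y ∈ S) (hy : y ∈ F L) :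
    |w K - w L| ≤ ∑ K', ∑ L', if (F K' ∩ F L' ∩ S).Nonempty then |w K' - w L'| else 0 := by
  let G : SimpleGraph T :=
    { Adj := fun a b => a ≠ b ∧ (F a ∩ F b ∩ S).Nonempty
      symm := ⟨fun a b h => ⟨h.1.symm, by rw [Set.inter_comm (F b)]; exact h.2⟩⟩
      loopless := ⟨fun a h => h.1 rfl⟩ }
  have hreach : G.Reachable K L := by
    by_contra hne
    have hA : IsClosed (⋃ a ∈ {a | G.Reachable K a}, F a) :=
      (Set.toFinite _).isClosed_biUnion fun a _ => hF a
    have hB : IsClosed (⋃ a ∈ {a | ¬ G.Reachable K a}, F a) :=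
      (Set.toFinite _).isClosed_biUnion fun a _ => hF a
    obtain ⟨z, hzS, hzA, hzB⟩ := isPreconnected_closed_iff.1 hS _ _ hA hB (fun z hz => by
        obtain ⟨a, ha⟩ := Set.mem_iUnion.1 (hcov hz)
        by_cases h : G.Reachable K a
        · exact Or.inl (Set.mem_biUnion (show a ∈ {a | G.Reachable K a} from h) ha)
        · exact Or.inr (Set.mem_biUnion (show a ∈ {a | ¬ G.Reachable K a} from h) ha))
      ⟨x, hxS, Set.mem_biUnion (show K ∈ {a | G.Reachable K a} from SimpleGraph.Reachable.refl K) hx⟩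
      ⟨y, hyS, Set.mem_biUnion (show L ∈ {a | ¬ G.Reachable K a} from hne) hy⟩
    simp only [Set.mem_iUnion, Set.mem_ofPred_eq] at hzA hzB
    obtain ⟨a, ha, hza⟩ := hzA
    obtain ⟨b, hb, hzb⟩ := hzB
    have hab : G.Adj a b := ⟨fun h => hb (h ▸ ha), z, ⟨hza, hzb⟩, hzS⟩
    exact hb (ha.trans hab.reachable)
  obtain ⟨p, hp⟩ := hreach.exists_isPath
  refine hp.abs_sub_le w _ (fun a b => by split_ifs <;> positivity) (fun a b h => ?_)
  rw [if_pos h.2]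

/-- A finite partition of `Ω`, up to a null set, into bounded open cells. -/
structure IsCellPartition {T : Type} (Ω : Set Plane) (c : T → Set Plane) : Prop where
  isOpen : ∀ K, IsOpen (c K)
  isBounded : ∀ K, Bornology.IsBounded (c K)
  subset : ∀ K, c K ⊆ Ω
  disjoint : ∀ K L, K ≠ L → Disjoint (c K) (c L)
  subset_closure : Ω ⊆ ⋃ K, closure (c K)
  volume_diff : volume (Ω \ ⋃ K, c K) = 0

/-- The total variation of the function with the value `w K` on the cell `c K`, each interface being
counted twice. The length of the interface of two cells is encoded as the diameter of the
intersection of their closures. -/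
noncomputable def jump {T : Type} [Fintype T] (c : T → Set Plane) (w : T → ℝ) : ℝ :=
  ∑ K, ∑ L, Metric.diam (closure (c K) ∩ closure (c L)) * |w K - w L|

theorem jump_nonneg {T : Type} [Fintype T] (c : T → Set Plane) (w : T → ℝ) : 0 ≤ jump c w :=
  Finset.sum_nonneg fun _ _ => Finset.sum_nonneg fun _ _ =>
    mul_nonneg Metric.diam_nonneg (abs_nonneg _)

/-- The double integral over `A × B` of the squared difference of the values, at two points, of the
function equal to `w K` on the cell `c K`. -/
noncomputable def crossVariance {T : Type} [Fintype T] (c : T → Set Plane) (w : T → ℝ)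
    (A B : Set Plane) : ℝ :=
  ∑ K, ∑ L, volume.real (c K ∩ A) * volume.real (c L ∩ B) * (w K - w L) ^ 2

theorem exists_volume_real_eq_preimage (A : Plane) (Λ : (ℝ × ℝ) ≃L[ℝ] Plane) :
    ∃ κ : ℝ, 0 ≤ κ ∧ ∀ X : Set Plane,
      volume.real X = κ * volume.real ((fun z => A + Λ z) ⁻¹' X) := by
  set μ : Measure Plane := (volume : Measure (ℝ × ℝ)).map Λ with hμ
  have hμ' : μ.IsAddHaarMeasure := Λ.isAddHaarMeasure_map _
  refine ⟨_, NNReal.coe_nonneg (Measure.addHaarScalarFactor volume μ), fun X => ?_⟩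
  have h1 := Measure.isAddLeftInvariant_eq_smul (volume : Measure Plane) μ
  have h2 : volume X = volume ((fun x => A + x) ⁻¹' X) := (measure_preimage_add volume A X).symm
  have h3 : μ ((fun x => A + x) ⁻¹' X) = volume ((fun z => A + Λ z) ⁻¹' X) := by
    rw [hμ]
    exact (Λ.toHomeomorph.toMeasurableEquiv).map_apply _
  have h4 : volume X = (Measure.addHaarScalarFactor volume μ : ENNReal) *
      volume ((fun z => A + Λ z) ⁻¹' X) := by
    rw [h2, ← h3]
    exact congrArg (fun m : Measure Plane => m ((fun x => A + x) ⁻¹' X)) h1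
  rw [Measure.real, h4, ENNReal.toReal_mul]
  rfl

theorem volume_real_image_le {f : Plane → ℝ} {k : NNReal} (hf : LipschitzWith k f) {S : Set Plane}
    (hS : Bornology.IsBounded S) : volume.real (f '' S) ≤ k * Metric.diam S := by
  have h1 : volume (f '' S) ≤ k * Metric.ediam S :=
    (Real.volume_le_diam _).trans (hf.ediam_image_le S)
  have h2 := ENNReal.toReal_mono (ENNReal.mul_ne_top ENNReal.coe_ne_top hS.ediam_ne_top) h1
  simpa [Measure.real, Metric.diam] using h2

/-! ### The BV inequality on a parallelogram -/

/-- Integration of a bound of `(w K - w L)²` by a product in which every factor depends on one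
coordinate of each of the two points. -/
theorem sum_measureReal_mul_le_sq {T : Type} [Fintype T] {ν : Measure ℝ} [IsProbabilityMeasure ν]
    {a b : ℝ → ℝ} (ha : Integrable a ν) (hb : Integrable b ν) (ha0 : ∀ t, 0 ≤ a t)
    (hb0 : ∀ t, 0 ≤ b t) {U : T → Set (ℝ × ℝ)} (hU : ∀ K, MeasurableSet (U K))
    (hd : ∀ K L, K ≠ L → Disjoint (U K) (U L)) {q : Set (ℝ × ℝ)}
    (hq : ∀ᵐ z ∂(ν.prod ν), z ∈ q) (w : T → ℝ)
    (h : ∀ z ∈ q, ∀ z' ∈ q, ∀ K L, z ∈ U K → z' ∈ U L →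
      (w K - w L) ^ 2 ≤ (a z.2 + b z'.1) * (b z.1 + a z'.2)) :
    ∑ K, ∑ L, (ν.prod ν).real (U K) * (ν.prod ν).real (U L) * (w K - w L) ^ 2
      ≤ ((∫ t, a t ∂ν) + ∫ t, b t ∂ν) ^ 2 := by
  classical
  set m := ν.prod ν with hm
  let ind : T → ℝ × ℝ → ℝ := fun K => (U K).indicator fun _ => 1
  have hind : ∀ K, Integrable (ind K) m := fun K =>
    (integrable_const (1 : ℝ)).indicator (hU K)
  have hindI : ∀ K, ∫ z, ind K z ∂m = m.real (U K) := fun K => by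
    simp only [ind]
    rw [integral_indicator (hU K)]; simp
  have hterm : ∀ K L, Integrable
      (fun x : (ℝ × ℝ) × (ℝ × ℝ) => ind K x.1 * ind L x.2 * (w K - w L) ^ 2) (m.prod m) :=
    fun K L => ((hind K).mul_prod (hind L)).mul_const _
  have hL : ∑ K, ∑ L, m.real (U K) * m.real (U L) * (w K - w L) ^ 2
      = ∫ x, ∑ K, ∑ L, ind K x.1 * ind L x.2 * (w K - w L) ^ 2 ∂(m.prod m) := by
    rw [integral_finsetSum _ fun K _ => integrable_finsetSum _ fun L _ => hterm K L]
    refine Finset.sum_congr rfl fun K _ => ?_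
    rw [integral_finsetSum _ fun L _ => hterm K L]
    refine Finset.sum_congr rfl fun L _ => ?_
    rw [integral_mul_const, integral_prod_mul, hindI, hindI]
  have ia1 : Integrable (fun z : ℝ × ℝ => a z.2) m := ha.comp_snd ν
  have ib1 : Integrable (fun z : ℝ × ℝ => b z.1) m := hb.comp_fst ν
  have iba : Integrable (fun z : ℝ × ℝ => b z.1 * a z.2) m := hb.mul_prod ha
  have i1 : Integrable (fun x : (ℝ × ℝ) × (ℝ × ℝ) => b x.1.1 * a x.1.2) (m.prod m) :=
    iba.comp_fst m
  have i2 : Integrable (fun x : (ℝ × ℝ) × (ℝ × ℝ) => a x.1.2 * a x.2.2) (m.prod m) :=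
    ia1.mul_prod ia1
  have i3 : Integrable (fun x : (ℝ × ℝ) × (ℝ × ℝ) => b x.1.1 * b x.2.1) (m.prod m) :=
    ib1.mul_prod ib1
  have i4 : Integrable (fun x : (ℝ × ℝ) × (ℝ × ℝ) => b x.2.1 * a x.2.2) (m.prod m) :=
    iba.comp_snd m
  have hA : ∫ z : ℝ × ℝ, a z.2 ∂m = ∫ t, a t ∂ν := by
    rw [hm, integral_fun_snd]; simp
  have hB : ∫ z : ℝ × ℝ, b z.1 ∂m = ∫ t, b t ∂ν := by
    rw [hm, integral_fun_fst]; simp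
  have hBA : ∫ z : ℝ × ℝ, b z.1 * a z.2 ∂m = (∫ t, b t ∂ν) * ∫ t, a t ∂ν :=
    integral_prod_mul b a
  have e1 : ∫ x : (ℝ × ℝ) × (ℝ × ℝ), b x.1.1 * a x.1.2 ∂(m.prod m)
      = (∫ t, b t ∂ν) * ∫ t, a t ∂ν := by
    rw [integral_fun_fst (fun z : ℝ × ℝ => b z.1 * a z.2), hBA]; simp
  have e4 : ∫ x : (ℝ × ℝ) × (ℝ × ℝ), b x.2.1 * a x.2.2 ∂(m.prod m)
      = (∫ t, b t ∂ν) * ∫ t, a t ∂ν := by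
    rw [integral_fun_snd (fun z : ℝ × ℝ => b z.1 * a z.2), hBA]; simp
  have e2 : ∫ x : (ℝ × ℝ) × (ℝ × ℝ), a x.1.2 * a x.2.2 ∂(m.prod m)
      = (∫ t, a t ∂ν) * ∫ t, a t ∂ν := by
    rw [integral_prod_mul (fun z : ℝ × ℝ => a z.2) (fun z : ℝ × ℝ => a z.2), hA]
  have e3 : ∫ x : (ℝ × ℝ) × (ℝ × ℝ), b x.1.1 * b x.2.1 ∂(m.prod m)
      = (∫ t, b t ∂ν) * ∫ t, b t ∂ν := by
    rw [integral_prod_mul (fun z : ℝ × ℝ => b z.1) (fun z : ℝ × ℝ => b z.1), hB]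
  have hR : ∫ x : (ℝ × ℝ) × (ℝ × ℝ),
      (b x.1.1 * a x.1.2 + a x.1.2 * a x.2.2) + (b x.1.1 * b x.2.1 + b x.2.1 * a x.2.2) ∂(m.prod m)
      = ((∫ t, a t ∂ν) + ∫ t, b t ∂ν) ^ 2 := by
    have := integral_add (i1.add i2) (i3.add i4)
    simp only [Pi.add_apply] at this
    rw [this, integral_add i1 i2, integral_add i3 i4, e1, e2, e3, e4]
    ring
  rw [hL, ← hR]
  have hq1 : ∀ᵐ x ∂(m.prod m), x.1 ∈ q := Measure.quasiMeasurePreserving_fst.ae hq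
  have hq2 : ∀ᵐ x ∂(m.prod m), x.2 ∈ q := Measure.quasiMeasurePreserving_snd.ae hq
  refine integral_mono_ae (integrable_finsetSum _ fun K _ =>
    integrable_finsetSum _ fun L _ => hterm K L) ((i1.add i2).add (i3.add i4)) ?_
  filter_upwards [hq1, hq2] with x hx1 hx2
  have hnn : 0 ≤ (b x.1.1 * a x.1.2 + a x.1.2 * a x.2.2)
      + (b x.1.1 * b x.2.1 + b x.2.1 * a x.2.2) := by
    have := ha0 x.1.2; have := ha0 x.2.2; have := hb0 x.1.1; have := hb0 x.2.1
    positivity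
  show _ ≤ (b x.1.1 * a x.1.2 + a x.1.2 * a x.2.2) + (b x.1.1 * b x.2.1 + b x.2.1 * a x.2.2)
  by_cases hK : ∃ K, x.1 ∈ U K
  · by_cases hLL : ∃ L, x.2 ∈ U L
    · obtain ⟨K, hK⟩ := hK
      obtain ⟨L, hLL⟩ := hLL
      have h0 : ∀ K', K' ≠ K → ind K' x.1 = 0 := fun K' hne =>
        Set.indicator_of_notMem (fun h' => (Set.disjoint_left.1 (hd K' K hne) h') hK) _
      have h0' : ∀ K', K' ≠ L → ind K' x.2 = 0 := fun K' hne =>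
        Set.indicator_of_notMem (fun h' => (Set.disjoint_left.1 (hd K' L hne) h') hLL) _
      have h1 : ind K x.1 = 1 := Set.indicator_of_mem hK _
      have h2 : ind L x.2 = 1 := Set.indicator_of_mem hLL _
      rw [Finset.sum_eq_single K (fun K' _ hne => by simp [h0 K' hne]) (by simp),
        Finset.sum_eq_single L (fun K' _ hne => by simp [h0' K' hne]) (by simp), h1, h2]
      have := h x.1 hx1 x.2 hx2 K L hK hLL
      linarith
    · push Not at hLL
      have h0' : ∀ K', ind K' x.2 = 0 := fun K' => Set.indicator_of_notMem (hLL K') _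
      simpa [h0'] using hnn
  · push Not at hK
    have h0' : ∀ K', ind K' x.1 = 0 := fun K' => Set.indicator_of_notMem (hK K') _
    simpa [h0'] using hnn

/-- The open parallelogram with vertex `A` that is the image of the unit square under
`z ↦ A + Λ z`. -/
def parallelogram (A : Plane) (Λ : (ℝ × ℝ) ≃L[ℝ] Plane) : Set Plane :=
  (fun z => A + Λ z) '' (Ioo (0 : ℝ) 1 ×ˢ Ioo (0 : ℝ) 1)

open Classical in
/-- The BV Sobolev inequality on a parallelogram. Two points are joined, inside the parallelogram,
by two paths consisting of one segment in either direction; the jumps along a segment depend on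
one coordinate only, and multiplying the bounds for the two paths gives a product that can be
integrated. -/
theorem exists_crossVariance_parallelogram_le (A : Plane) (Λ : (ℝ × ℝ) ≃L[ℝ] Plane) :
    ∃ C : ℝ, 0 ≤ C ∧ ∀ (Ω : Set Plane), parallelogram A Λ ⊆ Ω →
      ∀ (T : Type) [Fintype T] (c : T → Set Plane), IsCellPartition Ω c → ∀ w : T → ℝ,
      crossVariance c w (parallelogram A Λ) (parallelogram A Λ) ≤ C * jump c w ^ 2 := by
  obtain ⟨κ, hκ, hvol⟩ := exists_volume_real_eq_preimage A Λ
  set ψ : ℝ × ℝ → Plane := fun z => A + Λ z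
  have hψc : Continuous ψ := by fun_prop
  have hψi : Function.Injective ψ := fun z z' h => Λ.injective (add_left_cancel h)
  have hlip := Λ.symm.toContinuousLinearMap.lipschitz
  set k := ‖Λ.symm.toContinuousLinearMap‖₊
  let π : Plane → ℝ × ℝ := fun x => Λ.symm (x - A)
  have hπ : LipschitzWith k π := by
    intro x y
    have := hlip (x - A) (y - A)
    simpa [π] using this
  have hπψ : ∀ z, π (ψ z) = z := fun z => by simp [π, ψ]
  have hπ1 : LipschitzWith k fun x => (π x).1 := by
    have := LipschitzWith.prod_fst.comp hπ
    rwa [one_mul] at this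
  have hπ2 : LipschitzWith k fun x => (π x).2 := by
    have := LipschitzWith.prod_snd.comp hπ
    rwa [one_mul] at this
  refine ⟨κ ^ 2 * (2 * k) ^ 2, by positivity, fun Ω hP T _ c hc w => ?_⟩
  set ν : Measure ℝ := volume.restrict (Ioo (0 : ℝ) 1) with hν
  have : IsProbabilityMeasure ν := ⟨by simp [hν]⟩
  set q : Set (ℝ × ℝ) := Ioo (0 : ℝ) 1 ×ˢ Ioo (0 : ℝ) 1 with hq
  have hm : ν.prod ν = (volume : Measure (ℝ × ℝ)).restrict q := by
    rw [hν, Measure.prod_restrict]; rfl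
  let I : T → T → Set Plane := fun K L => closure (c K) ∩ closure (c L)
  have hIb : ∀ K L, Bornology.IsBounded (I K L) := fun K L =>
    (hc.isBounded K).closure.subset inter_subset_left
  have hIc : ∀ K L, IsCompact (I K L) := fun K L =>
    Metric.isCompact_of_isClosed_isBounded (isClosed_closure.inter isClosed_closure) (hIb K L)
  -- `g f t` bounds the jumps over the interfaces which have a point with coordinate `f = t`
  let g : (Plane → ℝ) → ℝ → ℝ := fun f t =>
    ∑ K, ∑ L, (f '' I K L).indicator (fun _ => |w K - w L|) t
  have hg0 : ∀ f t, 0 ≤ g f t := fun f t => Finset.sum_nonneg fun K _ =>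
    Finset.sum_nonneg fun L _ => Set.indicator_nonneg (fun _ _ => abs_nonneg _) _
  have hterm : ∀ f, Continuous f → ∀ K L,
      Integrable ((f '' I K L).indicator (fun _ => |w K - w L|)) ν := fun f hf K L =>
    (integrable_const _).indicator ((hIc K L).image hf).measurableSet
  have hgi : ∀ f, Continuous f → Integrable (g f) ν := fun f hf =>
    integrable_finsetSum _ fun K _ => integrable_finsetSum _ fun L _ => hterm f hf K L
  have hgI : ∀ f, LipschitzWith k f → ∫ t, g f t ∂ν ≤ k * jump c w := fun f hf => by
    simp only [g, jump]
    rw [integral_finsetSum _ fun K _ => integrable_finsetSum _ fun L _ => hterm f hf.continuous K L,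
      Finset.mul_sum]
    refine Finset.sum_le_sum fun K _ => ?_
    rw [integral_finsetSum _ fun L _ => hterm f hf.continuous K L, Finset.mul_sum]
    refine Finset.sum_le_sum fun L _ => ?_
    rw [integral_indicator ((hIc K L).image hf.continuous).measurableSet]
    have h1 : ν.real (f '' I K L) ≤ k * Metric.diam (I K L) := by
      refine le_trans ?_ (volume_real_image_le hf (hIb K L))
      exact ENNReal.toReal_mono (((hIc K L).image hf.continuous).measure_lt_top).ne
        (Measure.restrict_apply_le _ _)
    have h2 := mul_le_mul_of_nonneg_right h1 (abs_nonneg (w K - w L))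
    simpa [mul_assoc] using h2
  -- the path from `z` to `z'` with the corner `(z'.1, z.2)`
  have hpath : ∀ z ∈ q, ∀ z' ∈ q, ∀ K L, ψ z ∈ c K → ψ z' ∈ c L →
      |w K - w L| ≤ g (fun x => (π x).2) z.2 + g (fun x => (π x).1) z'.1 := by
    intro z hz z' hz' K L hzK hzL
    have hzz : ((z'.1, z.2) : ℝ × ℝ) ∈ q := ⟨hz'.1, hz.2⟩
    have hqc : Convex ℝ q := (convex_Ioo _ _).prod (convex_Ioo _ _)
    set S1 := segment ℝ z (z'.1, z.2)
    set S2 := segment ℝ ((z'.1, z.2) : ℝ × ℝ) z'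
    have hS : IsPreconnected (S1 ∪ S2) :=
      IsPreconnected.union _ (right_mem_segment ℝ _ _) (left_mem_segment ℝ _ _)
        (convex_segment _ _).isPreconnected (convex_segment _ _).isPreconnected
    have hSq : S1 ∪ S2 ⊆ q := union_subset (hqc.segment_subset hz hzz) (hqc.segment_subset hzz hz')
    have hS1' : ∀ y ∈ S1, y.2 = z.2 := by
      rintro y ⟨s, t, -, -, hst, rfl⟩
      simp only [Prod.snd_add, Prod.smul_snd, smul_eq_mul]
      rw [← add_mul, hst, one_mul]
    have hS2' : ∀ y ∈ S2, y.1 = z'.1 := by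
      rintro y ⟨s, t, -, -, hst, rfl⟩
      simp only [Prod.fst_add, Prod.smul_fst, smul_eq_mul]
      rw [← add_mul, hst, one_mul]
    have key := abs_sub_le_sum_of_isPreconnected (F := fun K => closure (c K))
      (fun K => isClosed_closure) (hS.image ψ hψc.continuousOn)
      (by
        rintro _ ⟨y, hy, rfl⟩
        exact hc.subset_closure (hP ⟨y, hSq hy, rfl⟩)) w
      (mem_image_of_mem ψ (Or.inl (left_mem_segment ℝ _ _))) (subset_closure hzK)
      (mem_image_of_mem ψ (Or.inr (right_mem_segment ℝ _ _))) (subset_closure hzL)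
    refine key.trans ?_
    simp only [g]
    rw [← Finset.sum_add_distrib]
    refine Finset.sum_le_sum fun K' _ => ?_
    rw [← Finset.sum_add_distrib]
    refine Finset.sum_le_sum fun L' _ => ?_
    have hn1 : 0 ≤ ((fun x => (π x).2) '' I K' L').indicator (fun _ => |w K' - w L'|) z.2 :=
      Set.indicator_nonneg (fun _ _ => abs_nonneg _) _
    have hn2 : 0 ≤ ((fun x => (π x).1) '' I K' L').indicator (fun _ => |w K' - w L'|) z'.1 :=
      Set.indicator_nonneg (fun _ _ => abs_nonneg _) _
    split_ifs with hne
    · obtain ⟨x, hxI, y, hy, rfl⟩ := hne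
      rcases hy with hy | hy
      · have : z.2 ∈ (fun x => (π x).2) '' I K' L' :=
          ⟨ψ y, hxI, by simp only [hπψ]; exact hS1' y hy⟩
        rw [Set.indicator_of_mem this]; linarith
      · have : z'.1 ∈ (fun x => (π x).1) '' I K' L' :=
          ⟨ψ y, hxI, by simp only [hπψ]; exact hS2' y hy⟩
        rw [Set.indicator_of_mem this]; linarith
    · linarith
  have main := sum_measureReal_mul_le_sq (ν := ν) (hgi _ hπ2.continuous) (hgi _ hπ1.continuous)
    (hg0 _) (hg0 _) (U := fun K => ψ ⁻¹' c K)
    (fun K => ((hc.isOpen K).preimage hψc).measurableSet)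
    (fun K L h => (hc.disjoint K L h).preimage ψ) (q := q)
    (by rw [hm]; exact ae_restrict_mem (measurableSet_Ioo.prod measurableSet_Ioo)) w
    (fun z hz z' hz' K L hK hL => by
      have h1 := hpath z hz z' hz' K L hK hL
      have h2 := hpath z' hz' z hz L K hL hK
      rw [abs_sub_comm] at h2
      rw [← sq_abs, sq]
      rw [add_comm (g (fun x => (π x).2) z'.2)] at h2
      exact mul_le_mul h1 h2 (abs_nonneg _) (add_nonneg (hg0 _ _) (hg0 _ _)))
  have hvolP : ∀ K, volume.real (c K ∩ parallelogram A Λ) = κ * (ν.prod ν).real (ψ ⁻¹' c K) := by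
    intro K
    have h1 : ψ ⁻¹' (c K ∩ parallelogram A Λ) = ψ ⁻¹' c K ∩ q := by
      rw [preimage_inter, parallelogram, hψi.preimage_image]
    rw [hvol, h1, hm]
    congr 1
    rw [Measure.real, Measure.real,
      Measure.restrict_apply ((hc.isOpen K).preimage hψc).measurableSet]
  have hI1 := hgI _ hπ1
  have hI2 := hgI _ hπ2
  have hI1' : 0 ≤ ∫ t, g (fun x => (π x).1) t ∂ν := integral_nonneg (hg0 _)
  have hI2' : 0 ≤ ∫ t, g (fun x => (π x).2) t ∂ν := integral_nonneg (hg0 _)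
  have hfin : ((∫ t, g (fun x => (π x).2) t ∂ν) + ∫ t, g (fun x => (π x).1) t ∂ν) ^ 2
      ≤ (2 * k * jump c w) ^ 2 := by
    refine pow_le_pow_left₀ (by linarith) (by linarith) 2
  have heq : crossVariance c w (parallelogram A Λ) (parallelogram A Λ) = κ ^ 2 *
      ∑ K, ∑ L, (ν.prod ν).real (ψ ⁻¹' c K) * (ν.prod ν).real (ψ ⁻¹' c L) * (w K - w L) ^ 2 := by
    simp only [crossVariance, hvolP, Finset.mul_sum]
    exact Finset.sum_congr rfl fun K _ => Finset.sum_congr rfl fun L _ => by ring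
  rw [heq]
  calc _ ≤ κ ^ 2 * (2 * k * jump c w) ^ 2 :=
        mul_le_mul_of_nonneg_left (main.trans hfin) (by positivity)
    _ = _ := by ring

/-! ### Chaining parallelograms in a connected open set -/

theorem isOpen_parallelogram (A : Plane) (Λ : (ℝ × ℝ) ≃L[ℝ] Plane) :
    IsOpen (parallelogram A Λ) :=
  (Λ.toHomeomorph.trans (Homeomorph.addLeft A)).isOpenMap _ (isOpen_Ioo.prod isOpen_Ioo)

theorem convex_parallelogram (A : Plane) (Λ : (ℝ × ℝ) ≃L[ℝ] Plane) :
    Convex ℝ (parallelogram A Λ) := by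
  have h := (((convex_Ioo (0 : ℝ) 1).prod (convex_Ioo (0 : ℝ) 1)).linear_image
    Λ.toLinearMap).translate A
  rwa [Set.image_image] at h

theorem crossVariance_comm {T : Type} [Fintype T] (c : T → Set Plane) (w : T → ℝ)
    (A B : Set Plane) : crossVariance c w A B = crossVariance c w B A := by
  unfold crossVariance
  rw [Finset.sum_comm]
  exact Finset.sum_congr rfl fun K _ => Finset.sum_congr rfl fun L _ => by ring

namespace IsCellPartition

variable {T : Type} {Ω : Set Plane} {c : T → Set Plane}

theorem volume_inter_ne_top (hc : IsCellPartition Ω c) (K : T) (A : Set Plane) :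
    volume (c K ∩ A) ≠ ⊤ :=
  ne_top_of_le_ne_top (hc.isBounded K).measure_lt_top.ne (measure_mono inter_subset_left)

theorem sum_volume_inter [Fintype T] (hc : IsCellPartition Ω c) {B : Set Plane} (hB : B ⊆ Ω) :
    ∑ K, volume.real (c K ∩ B) = volume.real B := by
  have h1 : volume.restrict B (⋃ K, c K) = ∑' K, volume.restrict B (c K) :=
    measure_iUnion (fun K L h => hc.disjoint K L h) fun K => (hc.isOpen K).measurableSet
  have h2 : volume.restrict B (⋃ K, c K) = volume B := by
    rw [Measure.restrict_apply (isOpen_iUnion hc.isOpen).measurableSet]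
    refine le_antisymm (measure_mono inter_subset_right) ?_
    calc volume B ≤ volume (((⋃ K, c K) ∩ B) ∪ (Ω \ ⋃ K, c K)) := measure_mono fun x hx => by
          by_cases h : x ∈ ⋃ K, c K
          · exact Or.inl ⟨h, hx⟩
          · exact Or.inr ⟨hB hx, h⟩
      _ ≤ _ := (measure_union_le _ _).trans (by rw [hc.volume_diff, add_zero])
  rw [h2, tsum_fintype] at h1
  rw [Measure.real, h1, ENNReal.toReal_sum]
  · exact Finset.sum_congr rfl fun K _ => by
      rw [Measure.restrict_apply (hc.isOpen K).measurableSet]; rfl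
  · intro K _
    rw [Measure.restrict_apply (hc.isOpen K).measurableSet]
    exact hc.volume_inter_ne_top K B

theorem crossVariance_mono [Fintype T] (hc : IsCellPartition Ω c) (w : T → ℝ)
    {A A' B B' : Set Plane} (hA : A ⊆ A') (hB : B ⊆ B') :
    crossVariance c w A B ≤ crossVariance c w A' B' := by
  refine Finset.sum_le_sum fun K _ => Finset.sum_le_sum fun L _ => ?_
  refine mul_le_mul_of_nonneg_right (mul_le_mul ?_ ?_ measureReal_nonneg measureReal_nonneg)
    (sq_nonneg _)
  · exact measureReal_mono (inter_subset_inter_right _ hA) (hc.volume_inter_ne_top K A')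
  · exact measureReal_mono (inter_subset_inter_right _ hB) (hc.volume_inter_ne_top L B')

theorem crossVariance_trans [Fintype T] (hc : IsCellPartition Ω c) (w : T → ℝ)
    {A B D : Set Plane} (hA : A ⊆ Ω) (hB : B ⊆ Ω) (hD : D ⊆ Ω) :
    volume.real B * crossVariance c w A D ≤
      2 * volume.real D * crossVariance c w A B + 2 * volume.real A * crossVariance c w B D := by
  unfold crossVariance
  rw [← hc.sum_volume_inter hB, ← hc.sum_volume_inter hA, ← hc.sum_volume_inter hD]
  set a : T → ℝ := fun K => volume.real (c K ∩ A)
  set b : T → ℝ := fun K => volume.real (c K ∩ B)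
  set d : T → ℝ := fun K => volume.real (c K ∩ D)
  have e1 : (∑ J, b J) * ∑ K, ∑ L, a K * d L * (w K - w L) ^ 2
      = ∑ K, ∑ L, ∑ J, b J * (a K * d L * (w K - w L) ^ 2) := by
    simp only [Finset.sum_mul, Finset.mul_sum]
  have e2 : 2 * (∑ L, d L) * ∑ K, ∑ J, a K * b J * (w K - w J) ^ 2
      = ∑ K, ∑ L, ∑ J, 2 * (d L * (a K * b J * (w K - w J) ^ 2)) := by
    rw [Finset.mul_sum]
    refine Finset.sum_congr rfl fun K _ => ?_
    rw [mul_assoc, Finset.sum_mul_sum, Finset.mul_sum]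
    simp only [Finset.mul_sum]
  have e3 : 2 * (∑ K, a K) * ∑ J, ∑ L, b J * d L * (w J - w L) ^ 2
      = ∑ K, ∑ L, ∑ J, 2 * (a K * (b J * d L * (w J - w L) ^ 2)) := by
    rw [mul_assoc, Finset.sum_mul_sum, Finset.mul_sum]
    refine Finset.sum_congr rfl fun K _ => ?_
    simp only [Finset.mul_sum]
    rw [Finset.sum_comm]
  rw [e1, e2, e3]
  simp only [← Finset.sum_add_distrib]
  refine Finset.sum_le_sum fun K _ => Finset.sum_le_sum fun L _ => Finset.sum_le_sum fun J _ => ?_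
  have h : 0 ≤ b J * (a K * d L) :=
    mul_nonneg measureReal_nonneg (mul_nonneg measureReal_nonneg measureReal_nonneg)
  have h2 : (w K - w L) ^ 2 ≤ 2 * (w K - w J) ^ 2 + 2 * (w J - w L) ^ 2 := by
    linarith [sq_nonneg (w K - w J - (w J - w L)), sq_nonneg (w K - w J + (w J - w L)),
      show (w K - w L) ^ 2 = (w K - w J + (w J - w L)) ^ 2 by ring]
  linarith [mul_le_mul_of_nonneg_left h2 h]

theorem crossVariance_le_sum [Fintype T] (hc : IsCellPartition Ω c) (w : T → ℝ) {ι : Type*}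
    (s : Finset ι) {A B : Set Plane} {P : ι → Set Plane}
    (hA : volume (A \ ⋃ i ∈ s, P i) = 0) :
    crossVariance c w A B ≤ ∑ i ∈ s, crossVariance c w (P i) B := by
  unfold crossVariance
  conv_rhs => rw [Finset.sum_comm]
  refine Finset.sum_le_sum fun K _ => ?_
  conv_rhs => rw [Finset.sum_comm]
  refine Finset.sum_le_sum fun L _ => ?_
  rw [← Finset.sum_mul, ← Finset.sum_mul]
  refine mul_le_mul_of_nonneg_right (mul_le_mul_of_nonneg_right ?_ measureReal_nonneg)
    (sq_nonneg _)
  have h1 : volume (c K ∩ A) ≤ ∑ i ∈ s, volume (c K ∩ P i) :=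
    calc volume (c K ∩ A) ≤ volume ((⋃ i ∈ s, c K ∩ P i) ∪ (A \ ⋃ i ∈ s, P i)) :=
          measure_mono fun x hx => by
            by_cases h : x ∈ ⋃ i ∈ s, P i
            · left
              simp only [mem_iUnion] at h ⊢
              obtain ⟨i, hi, hxi⟩ := h
              exact ⟨i, hi, hx.1, hxi⟩
            · exact Or.inr ⟨hx.2, h⟩
      _ ≤ volume (⋃ i ∈ s, c K ∩ P i) + 0 := by rw [← hA]; exact measure_union_le _ _
      _ ≤ _ := by rw [add_zero]; exact measure_biUnion_finset_le _ _
  have h2 := ENNReal.toReal_mono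
    (ENNReal.sum_ne_top.2 fun i _ => hc.volume_inter_ne_top K (P i)) h1
  rwa [ENNReal.toReal_sum fun i _ => hc.volume_inter_ne_top K (P i)] at h2

end IsCellPartition

/-- `A` and `B` are linked in `Ω` if a Poincaré-Sobolev inequality, with the total variation over
`Ω`, controls the oscillation between `A` and `B` uniformly in the partition of `Ω`. -/
def Linked (Ω A B : Set Plane) : Prop :=
  ∃ C : ℝ, 0 ≤ C ∧ ∀ (T : Type) [Fintype T] (c : T → Set Plane), IsCellPartition Ω c →
    ∀ w : T → ℝ, crossVariance c w A B ≤ C * jump c w ^ 2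

namespace Linked

variable {Ω A B D : Set Plane}

theorem symm (h : Linked Ω A B) : Linked Ω B A := by
  obtain ⟨C, hC, h⟩ := h
  exact ⟨C, hC, fun T _ c hc w => crossVariance_comm c w A B ▸ h T c hc w⟩

theorem mono {A' B' : Set Plane} (h : Linked Ω A' B') (hA : A ⊆ A') (hB : B ⊆ B') :
    Linked Ω A B := by
  obtain ⟨C, hC, h⟩ := h
  exact ⟨C, hC, fun T _ c hc w => (hc.crossVariance_mono w hA hB).trans (h T c hc w)⟩

/-- Linkage is transitive if the set in the middle has positive measure. -/
theorem trans (hAB : Linked Ω A B) (hBD : Linked Ω B D) (hA : A ⊆ Ω) (hB : B ⊆ Ω) (hD : D ⊆ Ω)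
    (hpos : 0 < volume.real B) : Linked Ω A D := by
  obtain ⟨C, hC, h⟩ := hAB
  obtain ⟨C', hC', h'⟩ := hBD
  refine ⟨(2 * volume.real D * C + 2 * volume.real A * C') / volume.real B, by positivity,
    fun T _ c hc w => ?_⟩
  have h1 := hc.crossVariance_trans w hA hB hD
  have h2 := mul_le_mul_of_nonneg_left (h T c hc w)
    (by positivity : 0 ≤ 2 * volume.real D)
  have h3 := mul_le_mul_of_nonneg_left (h' T c hc w)
    (by positivity : 0 ≤ 2 * volume.real A)
  rw [div_mul_eq_mul_div, le_div_iff₀ hpos]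
  linarith

theorem of_cover {ι : Type*} (s : Finset ι) {P : ι → Set Plane}
    (hA : volume (A \ ⋃ i ∈ s, P i) = 0) (h : ∀ i ∈ s, Linked Ω (P i) B) : Linked Ω A B := by
  classical
  have h' : ∀ i : s, Linked Ω (P i) B := fun i => h i i.2
  choose C hC hCw using h'
  refine ⟨∑ i, C i, Finset.sum_nonneg fun i _ => hC i, fun T _ c hc w => ?_⟩
  refine (hc.crossVariance_le_sum w s hA).trans ?_
  rw [Finset.sum_mul, ← Finset.sum_coe_sort s]
  exact Finset.sum_le_sum fun i _ => hCw i T c hc w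

end Linked

theorem Linked.parallelogram_self {Ω A' : Set Plane} {A : Plane} {Λ : (ℝ × ℝ) ≃L[ℝ] Plane}
    (hA : A' = parallelogram A Λ) (h : A' ⊆ Ω) : Linked Ω A' A' := by
  subst hA
  obtain ⟨C, hC, hw⟩ := exists_crossVariance_parallelogram_le A Λ
  exact ⟨C, hC, fun T _ c hc w => hw Ω h T c hc w⟩

theorem volume_real_pos_of_isOpen {U : Set Plane} (hU : IsOpen U) (hne : U.Nonempty)
    (hb : volume U ≠ ⊤) : 0 < volume.real U :=
  ENNReal.toReal_pos (hU.measure_pos volume hne).ne' hb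

theorem isBounded_parallelogram (A : Plane) (Λ : (ℝ × ℝ) ≃L[ℝ] Plane) :
    Bornology.IsBounded (parallelogram A Λ) := by
  have h : IsCompact ((fun z => A + Λ z) '' (Icc (0 : ℝ) 1 ×ˢ Icc (0 : ℝ) 1)) :=
    (isCompact_Icc.prod isCompact_Icc).image (by fun_prop)
  exact h.isBounded.subset (image_mono (prod_mono Ioo_subset_Icc_self Ioo_subset_Icc_self))

theorem Linked.parallelogram_of_inter {Ω : Set Plane} {A B : Plane}
    {Λ Λ' : (ℝ × ℝ) ≃L[ℝ] Plane} (hA : parallelogram A Λ ⊆ Ω) (hB : parallelogram B Λ' ⊆ Ω)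
    (h : (parallelogram A Λ ∩ parallelogram B Λ').Nonempty) :
    Linked Ω (parallelogram A Λ) (parallelogram B Λ') := by
  have h1 := Linked.parallelogram_self rfl hA
  have h2 := Linked.parallelogram_self rfl hB
  refine (h1.mono subset_rfl inter_subset_left).trans (h2.mono inter_subset_right subset_rfl)
    hA (inter_subset_left.trans hA) hB (volume_real_pos_of_isOpen
      ((isOpen_parallelogram A Λ).inter (isOpen_parallelogram B Λ')) h ?_)
  exact ((isBounded_parallelogram A Λ).subset inter_subset_left).measure_lt_top.ne

theorem exists_parallelogram_subset {U : Set Plane} (hU : IsOpen U) {x : Plane} (hx : x ∈ U) :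
    ∃ A Λ, x ∈ parallelogram A Λ ∧ parallelogram A Λ ⊆ U := by
  let Λ₀ : (ℝ × ℝ) ≃L[ℝ] Plane := ContinuousLinearEquiv.ofFinrankEq (by simp)
  have hc2 : Continuous (fun z : ℝ × ℝ => x + Λ₀ z) := by fun_prop
  have hnhds : (fun z : ℝ × ℝ => x + Λ₀ z) ⁻¹' U ∈ nhds (0 : ℝ × ℝ) :=
    hc2.continuousAt.preimage_mem_nhds (by simpa using hU.mem_nhds hx)
  obtain ⟨ε, hε, hball⟩ := Metric.mem_nhds_iff.1 hnhds
  let Λ : (ℝ × ℝ) ≃L[ℝ] Plane :=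
    (ContinuousLinearEquiv.smulLeft (Units.mk0 (2 * ε) (by positivity))).trans Λ₀
  have hΛ : ∀ z, Λ z = Λ₀ ((2 * ε) • z) := fun z => rfl
  refine ⟨x - Λ₀ (ε, ε), Λ, ⟨(1 / 2, 1 / 2), by constructor <;> norm_num, ?_⟩, ?_⟩
  · have : (2 * ε) • ((1 / 2, 1 / 2) : ℝ × ℝ) = (ε, ε) := by
      ext <;> simp <;> ring
    simp only [hΛ, this, sub_add_cancel]
  · rintro _ ⟨z, ⟨hz1, hz2⟩, rfl⟩
    have hmem : (2 * ε) • z - (ε, ε) ∈ Metric.ball (0 : ℝ × ℝ) ε := by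
      rw [mem_ball_zero_iff, Prod.norm_def, max_lt_iff]
      simp only [Prod.fst_sub, Prod.snd_sub, Prod.smul_fst, Prod.smul_snd, smul_eq_mul,
        Real.norm_eq_abs, abs_lt]
      obtain ⟨h1, h2⟩ := hz1
      obtain ⟨h3, h4⟩ := hz2
      refine ⟨⟨?_, ?_⟩, ?_, ?_⟩ <;> nlinarith
    have := hball hmem
    simp only [mem_preimage, map_sub] at this
    simp only [hΛ]
    convert this using 1
    abel

/-- In a connected open set all parallelograms are linked, since overlapping ones are. -/
theorem Linked.parallelogram_of_isConnected {Ω : Set Plane} (hΩ : IsOpen Ω) (hc : IsPreconnected Ω)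
    {A B : Plane} {Λ Λ' : (ℝ × ℝ) ≃L[ℝ] Plane} (hA : parallelogram A Λ ⊆ Ω)
    (hB : parallelogram B Λ' ⊆ Ω) : Linked Ω (parallelogram A Λ) (parallelogram B Λ') := by
  let P : Plane → Plane → Prop := fun x y => ∀ A Λ B Λ', x ∈ parallelogram A Λ →
    parallelogram A Λ ⊆ Ω → y ∈ parallelogram B Λ' → parallelogram B Λ' ⊆ Ω →
      Linked Ω (parallelogram A Λ) (parallelogram B Λ')
  have htrans : ∀ {A B D : Plane} {Λ Λ' Λ'' : (ℝ × ℝ) ≃L[ℝ] Plane}, parallelogram A Λ ⊆ Ω →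
      parallelogram B Λ' ⊆ Ω → parallelogram D Λ'' ⊆ Ω → (parallelogram B Λ').Nonempty →
      Linked Ω (parallelogram A Λ) (parallelogram B Λ') →
      Linked Ω (parallelogram B Λ') (parallelogram D Λ'') →
      Linked Ω (parallelogram A Λ) (parallelogram D Λ'') :=
    fun {A B D Λ Λ' Λ''} hA hB hD hne h1 h2 => h1.trans h2 hA hB hD
      (volume_real_pos_of_isOpen (isOpen_parallelogram B Λ') hne
        (isBounded_parallelogram B Λ').measure_lt_top.ne)
  have hne : ∀ (A : Plane) (Λ : (ℝ × ℝ) ≃L[ℝ] Plane), (parallelogram A Λ).Nonempty := fun A Λ =>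
    ⟨_, (1 / 2, 1 / 2), by constructor <;> norm_num, rfl⟩
  obtain ⟨x, hx⟩ := hne A Λ
  obtain ⟨y, hy⟩ := hne B Λ'
  have hP : P x y := by
    refine hc.induction₂ P (fun x hx => ?_) (fun x y z _ hy _ h1 h2 A Λ B Λ' h3 h4 h5 h6 => ?_)
      (fun x y _ _ h A Λ B Λ' h1 h2 h3 h4 => (h B Λ' A Λ h3 h4 h1 h2).symm) (hA hx) (hB hy)
    · obtain ⟨D, Λd, hxD, hD⟩ := exists_parallelogram_subset hΩ hx
      filter_upwards [mem_nhdsWithin_of_mem_nhds ((isOpen_parallelogram D Λd).mem_nhds hxD)]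
        with y hy A Λ B Λ' h1 h2 h3 h4
      exact htrans h2 hD h4 ⟨x, hxD⟩ (Linked.parallelogram_of_inter h2 hD ⟨x, h1, hxD⟩)
        (Linked.parallelogram_of_inter hD h4 ⟨y, hy, h3⟩)
    · obtain ⟨D, Λd, hyD, hD⟩ := exists_parallelogram_subset hΩ hy
      exact htrans h4 hD h6 ⟨y, hyD⟩ (h1 A Λ D Λd h3 h4 hyD hD) (h2 D Λd B Λ' hyD hD h5 h6)
  exact hP A Λ B Λ' hx hA hy hB

/-! ### The BV inequality on a polygonal domain -/

/-- `X` is filled, up to a null set, by finitely many parallelograms contained in it. -/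
def HasParallelogramCover (X : Set Plane) : Prop :=
  ∃ s : Finset (Plane × ((ℝ × ℝ) ≃L[ℝ] Plane)), (∀ j ∈ s, parallelogram j.1 j.2 ⊆ X) ∧
    volume (X \ ⋃ j ∈ s, parallelogram j.1 j.2) = 0

namespace HasParallelogramCover

theorem of_volume_eq_zero {X : Set Plane} (hX : volume X = 0) : HasParallelogramCover X :=
  ⟨∅, by simp, by simpa using hX⟩

theorem union {X Y : Set Plane} (hX : HasParallelogramCover X) (hY : HasParallelogramCover Y) :
    HasParallelogramCover (X ∪ Y) := by
  classical
  obtain ⟨s, hs, hs0⟩ := hX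
  obtain ⟨t, ht, ht0⟩ := hY
  refine ⟨s ∪ t, fun j hj => ?_, ?_⟩
  · rcases Finset.mem_union.1 hj with h | h
    · exact (hs j h).trans subset_union_left
    · exact (ht j h).trans subset_union_right
  · refine measure_mono_null (fun x hx => ?_) (measure_union_null hs0 ht0)
    obtain ⟨hx, hn⟩ := hx
    simp only [mem_iUnion, Finset.mem_union, not_exists, exists_prop, not_and] at hn
    rcases hx with hx | hx
    · left
      refine ⟨hx, fun h => ?_⟩
      simp only [mem_iUnion, exists_prop] at h
      obtain ⟨j, hj, hj'⟩ := h
      exact hn j (Or.inl hj) hj'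
    · right
      refine ⟨hx, fun h => ?_⟩
      simp only [mem_iUnion, exists_prop] at h
      obtain ⟨j, hj, hj'⟩ := h
      exact hn j (Or.inr hj) hj'

theorem biUnion {ι : Type*} (s : Finset ι) {X : ι → Set Plane}
    (h : ∀ i ∈ s, HasParallelogramCover (X i)) : HasParallelogramCover (⋃ i ∈ s, X i) := by
  classical
  induction s using Finset.induction_on with
  | empty => exact of_volume_eq_zero (by simp)
  | insert a s ha ih =>
    rw [Finset.set_biUnion_insert]
    exact (h a (Finset.mem_insert_self _ _)).union
      (ih fun i hi => h i (Finset.mem_insert_of_mem hi))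

end HasParallelogramCover

theorem exists_continuousLinearEquiv_of_span_eq_top {u v : Plane}
    (h : Submodule.span ℝ ({u, v} : Set Plane) = ⊤) :
    ∃ Λ : (ℝ × ℝ) ≃L[ℝ] Plane, ∀ s t, Λ (s, t) = s • u + t • v := by
  let f : (ℝ × ℝ) →ₗ[ℝ] Plane :=
    (LinearMap.fst ℝ ℝ ℝ).smulRight u + (LinearMap.snd ℝ ℝ ℝ).smulRight v
  have hf : ∀ s t, f (s, t) = s • u + t • v := fun s t => by simp [f]
  have hsurj : Function.Surjective f := by
    intro x
    have hx : x ∈ Submodule.span ℝ ({u, v} : Set Plane) := h ▸ Submodule.mem_top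
    obtain ⟨s, t, rfl⟩ := Submodule.mem_span_pair.1 hx
    exact ⟨(s, t), hf s t⟩
  have hinj : Function.Injective f :=
    (LinearMap.injective_iff_surjective_of_finrank_eq_finrank (by simp)).2 hsurj
  exact ⟨(LinearEquiv.ofBijective f ⟨hinj, hsurj⟩).toContinuousLinearEquiv, hf⟩

/-- The corner `A + β (B - A) + γ (C - A)`, `0 < β, γ < 1 / 2`, of a triangle. -/
theorem exists_corner_parallelogram {A B C : Plane}
    (h : affineSpan ℝ ({A, B, C} : Set Plane) = ⊤) :
    ∃ Λ : (ℝ × ℝ) ≃L[ℝ] Plane, parallelogram A Λ ⊆ convexHull ℝ {A, B, C} ∧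
      ∀ α β γ : ℝ, 0 ≤ β → 0 ≤ γ → α + β + γ = 1 → β ≤ 1 / 2 → γ ≤ 1 / 2 →
        α • A + β • B + γ • C ∈ closure (parallelogram A Λ) := by
  have hspan : Submodule.span ℝ ({B - A, C - A} : Set Plane) = ⊤ := by
    have h1 : vectorSpan ℝ ({A, B, C} : Set Plane) = ⊤ := by
      rw [← direction_affineSpan, h, AffineSubspace.direction_top]
    rw [vectorSpan_eq_span_vsub_set_right ℝ (mem_insert A _)] at h1
    simpa [image_insert_eq] using h1
  obtain ⟨Λ₀, hΛ₀⟩ := exists_continuousLinearEquiv_of_span_eq_top hspan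
  let Λ : (ℝ × ℝ) ≃L[ℝ] Plane :=
    (ContinuousLinearEquiv.smulLeft (Units.mk0 (1 / 2 : ℝ) (by norm_num))).trans Λ₀
  have hΛ : ∀ s t, Λ (s, t) = (s / 2) • (B - A) + (t / 2) • (C - A) := fun s t => by
    rw [← hΛ₀]
    show Λ₀ ((1 / 2 : ℝ) • (s, t)) = _
    congr 1
    ext <;> simp <;> ring
  refine ⟨Λ, ?_, fun α β γ hβ hγ hsum hβ2 hγ2 => ?_⟩
  · rintro _ ⟨⟨s, t⟩, ⟨hs, ht⟩, rfl⟩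
    have hx : A + Λ (s, t) = (1 - s / 2 - t / 2) • A + ((s / 2) • B + (t / 2) • C) := by
      rw [hΛ]; module
    simp only [mem_Ioo] at hs ht
    show A + Λ (s, t) ∈ _
    have hsub := subset_convexHull ℝ ({A, B, C} : Set Plane)
    rw [hx, ← add_assoc]
    have := (convex_convexHull ℝ ({A, B, C} : Set Plane)).sum_mem (t := Finset.univ)
      (w := ![1 - s / 2 - t / 2, s / 2, t / 2]) (z := ![A, B, C])
      (by intro i _; fin_cases i <;> simp <;> linarith)
      (by simp [Fin.sum_univ_three]; ring) (by intro i _; fin_cases i <;> apply hsub <;> simp)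
    simpa [Fin.sum_univ_three] using this
  · have hx : α • A + β • B + γ • C = A + Λ (2 * β, 2 * γ) := by
      rw [hΛ, show α = 1 - β - γ by linarith]
      rw [show 2 * β / 2 = β by ring, show 2 * γ / 2 = γ by ring]
      module
    rw [hx]
    have hcl : ((2 * β, 2 * γ) : ℝ × ℝ) ∈ closure (Ioo (0 : ℝ) 1 ×ˢ Ioo (0 : ℝ) 1) := by
      rw [closure_prod_eq, closure_Ioo (by norm_num)]
      exact ⟨⟨by positivity, by simp only; linarith⟩, ⟨by positivity, by simp only; linarith⟩⟩
    have hcont : Continuous fun z : ℝ × ℝ => A + Λ z := by fun_prop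
    exact image_closure_subset_closure_image hcont ⟨_, hcl, rfl⟩

theorem volume_closure_parallelogram_diff (A : Plane) (Λ : (ℝ × ℝ) ≃L[ℝ] Plane) :
    volume (closure (parallelogram A Λ) \ parallelogram A Λ) = 0 := by
  have h := (convex_parallelogram A Λ).addHaar_frontier (volume : Measure Plane)
  rwa [frontier, (isOpen_parallelogram A Λ).interior_eq] at h

/-- A triangle is the union of the parallelograms spanned, at each vertex, by the halves of the two
adjacent sides. -/
theorem hasParallelogramCover_triangle {A B C : Plane}
    (h : affineSpan ℝ ({A, B, C} : Set Plane) = ⊤) :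
    HasParallelogramCover (convexHull ℝ {A, B, C}) := by
  classical
  have hBA : ({B, A, C} : Set Plane) = {A, B, C} := Set.insert_comm _ _ _
  have hCA : ({C, A, B} : Set Plane) = {A, B, C} := by
    rw [Set.insert_comm, Set.pair_comm C B]
  obtain ⟨Λ₁, hs₁, h₁⟩ := exists_corner_parallelogram h
  obtain ⟨Λ₂, hs₂, h₂⟩ := exists_corner_parallelogram (A := B) (B := A) (C := C) (by rwa [hBA])
  obtain ⟨Λ₃, hs₃, h₃⟩ := exists_corner_parallelogram (A := C) (B := A) (C := B) (by rwa [hCA])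
  rw [hBA] at hs₂
  rw [hCA] at hs₃
  refine ⟨{(A, Λ₁), (B, Λ₂), (C, Λ₃)}, ?_, ?_⟩
  · intro j hj
    simp only [Finset.mem_insert, Finset.mem_singleton] at hj
    rcases hj with rfl | rfl | rfl <;> assumption
  · refine measure_mono_null ?_ (measure_union_null (volume_closure_parallelogram_diff A Λ₁)
      (measure_union_null (volume_closure_parallelogram_diff B Λ₂)
        (volume_closure_parallelogram_diff C Λ₃)))
    rintro x ⟨hx, hn⟩
    simp only [Finset.mem_insert, Finset.mem_singleton, iUnion_iUnion_eq_or_left,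
      iUnion_iUnion_eq_left, mem_union, not_or] at hn
    rw [convexHull_insert (by simp), convexHull_pair, mem_convexJoin] at hx
    obtain ⟨a, rfl, b, ⟨s, t, hs, ht, hst, rfl⟩, ⟨α, β, hα, hβ, hαβ, rfl⟩⟩ := hx
    have e : α • a + β • (s • B + t • C) = α • a + (β * s) • B + (β * t) • C := by
      module
    rw [e] at hn ⊢
    have hsum : α + β * s + β * t = 1 := by
      rw [add_assoc, ← mul_add, hst, mul_one, hαβ]
    have h1 : 0 ≤ β * s := by positivity
    have h2 : 0 ≤ β * t := by positivity
    by_cases hb : β * s ≤ 1 / 2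
    · by_cases hc : β * t ≤ 1 / 2
      · exact Or.inl ⟨h₁ α _ _ h1 h2 hsum hb hc, hn.1⟩
      · refine Or.inr (Or.inr ⟨?_, hn.2.2⟩)
        have := h₃ (β * t) α (β * s) hα h1 (by linarith) (by linarith) hb
        convert this using 1
        abel
    · refine Or.inr (Or.inl ⟨?_, hn.2.1⟩)
      have := h₂ (β * s) α (β * t) hα h2 (by linarith) (by linarith) (by linarith)
      convert this using 1
      abel

theorem hasParallelogramCover_convexHull (s : Finset Plane) :
    HasParallelogramCover (convexHull ℝ (s : Set Plane)) := by
  classical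
  have hcar : convexHull ℝ (s : Set Plane) =
      ⋃ t ∈ s.powerset.filter fun t : Finset Plane => AffineIndependent ℝ ((↑) : t → Plane),
        convexHull ℝ (t : Set Plane) := by
    rw [convexHull_eq_union]
    ext x
    simp only [mem_iUnion, Finset.mem_filter, Finset.mem_powerset, Finset.coe_subset, exists_prop,
      and_assoc]
  rw [hcar]
  refine HasParallelogramCover.biUnion _ fun t ht => ?_
  have hind := (Finset.mem_filter.1 ht).2
  by_cases htop : affineSpan ℝ (t : Set Plane) = ⊤
  · have hcard : t.card = 3 := by
      have h1 := (hind.affineSpan_eq_top_iff_card_eq_finrank_add_one (k := ℝ)).1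
        (by simpa using htop)
      simpa using h1
    obtain ⟨A, B, C, -, -, -, rfl⟩ := Finset.card_eq_three.1 hcard
    have e : (({A, B, C} : Finset Plane) : Set Plane) = {A, B, C} := by simp
    rw [e] at htop ⊢
    exact hasParallelogramCover_triangle htop
  · refine HasParallelogramCover.of_volume_eq_zero (measure_mono_null ?_
      (Measure.addHaar_affineSubspace volume (affineSpan ℝ (t : Set Plane)) htop))
    exact convexHull_subset_affineSpan _

namespace IsPolygonalDomain

variable {Ω : Set Plane}

theorem isOpen (h : IsPolygonalDomain Ω) : IsOpen Ω := by
  obtain ⟨F, rfl⟩ := h.polygonal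
  exact isOpen_interior

theorem isBounded (h : IsPolygonalDomain Ω) : Bornology.IsBounded Ω := by
  obtain ⟨F, rfl⟩ := h.polygonal
  refine Bornology.IsBounded.subset ?_ interior_subset
  exact (Bornology.isBounded_biUnion_finset F).2 fun s _ =>
    isBounded_convexHull.2 s.finite_toSet.isBounded

theorem hasParallelogramCover (h : IsPolygonalDomain Ω) : HasParallelogramCover Ω := by
  obtain ⟨F, hF⟩ := h.polygonal
  obtain ⟨s, hs, hs0⟩ := HasParallelogramCover.biUnion F
    (X := fun s => convexHull ℝ (s : Set Plane)) fun s _ => hasParallelogramCover_convexHull s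
  refine ⟨s, fun j hj => ?_, measure_mono_null (sdiff_subset_sdiff_left ?_) hs0⟩
  · rw [hF]
    exact interior_maximal (hs j hj) (isOpen_parallelogram _ _)
  · rw [hF]; exact interior_subset

/-- The BV Poincaré-Sobolev inequality on a polygonal domain. -/
theorem linked_self (h : IsPolygonalDomain Ω) : Linked Ω Ω Ω := by
  obtain ⟨s, hs, hs0⟩ := h.hasParallelogramCover
  refine Linked.of_cover s hs0 fun i hi => Linked.symm (Linked.of_cover s hs0 fun j hj => ?_)
  exact Linked.parallelogram_of_isConnected h.isOpen h.connected.isPreconnected (hs j hj) (hs i hi)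

end IsPolygonalDomain

/-! ### Scalar inequalities for the entropy functions -/

/-- The derivative of `Phi p` on the positive half line. -/
noncomputable def dPhi (p s : ℝ) : ℝ :=
  if p = 1 then Real.log s else p / (p - 1) * (s ^ (p - 1) - 1)

theorem dPhi_mono {p : ℝ} (hp : 1 ≤ p) {x y : ℝ} (hx : 0 < x) (hxy : x ≤ y) :
    dPhi p x ≤ dPhi p y := by
  unfold dPhi
  split_ifs with h
  · exact Real.log_le_log hx hxy
  · have h1 : 0 < p - 1 := sub_pos.2 (lt_of_le_of_ne hp (Ne.symm h))
    have h2 := Real.rpow_le_rpow hx.le hxy h1.le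
    gcongr

theorem rpow_tangent_le {p : ℝ} (hp : 1 ≤ p) {a b : ℝ} (ha : 0 ≤ a) (hb : 0 < b) :
    b ^ p + p * b ^ (p - 1) * (a - b) ≤ a ^ p := by
  have h := one_add_mul_self_le_rpow_one_add (s := a / b - 1) (by
    have : 0 ≤ a / b := by positivity
    linarith) hp
  rw [add_sub_cancel, Real.div_rpow ha hb.le, le_div_iff₀ (by positivity)] at h
  have hbp : b ^ p = b ^ (p - 1) * b := by
    rw [Real.rpow_sub_one hb.ne']; field_simp
  calc b ^ p + p * b ^ (p - 1) * (a - b) = (1 + p * (a / b - 1)) * b ^ p := by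
        rw [hbp]; field_simp
    _ ≤ a ^ p := h

theorem mul_log_tangent_le {a b : ℝ} (ha : 0 ≤ a) (hb : 0 < b) :
    a * Real.log b + a - b ≤ a * Real.log a := by
  rcases ha.eq_or_lt with rfl | ha
  · simp [hb.le]
  · have h := Real.log_le_sub_one_of_pos (show 0 < b / a by positivity)
    rw [Real.log_div hb.ne' ha.ne'] at h
    have h2 := mul_le_mul_of_nonneg_left h ha.le
    have h3 : a * (b / a - 1) = b - a := by field_simp
    rw [h3] at h2
    linarith

/-- Convexity of `Phi p`. -/
theorem Phi_tangent_le {p : ℝ} (hp : 1 ≤ p) {a b : ℝ} (ha : 0 ≤ a) (hb : 0 < b) :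
    Phi p b + dPhi p b * (a - b) ≤ Phi p a := by
  unfold Phi dPhi
  split_ifs with h
  · linarith [mul_log_tangent_le ha hb]
  · have h1 : 0 < p - 1 := sub_pos.2 (lt_of_le_of_ne hp (Ne.symm h))
    have h2 := rpow_tangent_le hp ha hb
    have h3 := div_le_div_of_nonneg_right h2 h1.le
    have e : (b ^ p - p * b) / (p - 1) + 1 + p / (p - 1) * (b ^ (p - 1) - 1) * (a - b)
        = (b ^ p + p * b ^ (p - 1) * (a - b)) / (p - 1) - p * a / (p - 1) + 1 := by
      field_simp; ring
    rw [e, sub_div]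
    linarith

theorem Phi_nonneg {p : ℝ} (hp : 1 ≤ p) {a : ℝ} (ha : 0 ≤ a) : 0 ≤ Phi p a := by
  have h := Phi_tangent_le hp ha one_pos
  have h1 : Phi p 1 = 0 := by
    unfold Phi
    split_ifs with h
    · simp
    · have : p - 1 ≠ 0 := sub_ne_zero.2 h
      rw [Real.one_rpow]; field_simp; ring
  have h2 : dPhi p 1 = 0 := by unfold dPhi; split_ifs <;> simp
  rw [h1, h2] at h
  linarith

theorem rpow_mul_sub_le {p : ℝ} (hp : 1 < p) (hp2 : p ≤ 2) {x y : ℝ} (hx : 0 < x) (hy : 0 < y) :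
    x * y ^ (p - 1) ≤ (2 / p - 1) * x ^ p + (2 - 2 / p) * (x ^ (p / 2) * y ^ (p / 2)) := by
  have hp0 : 0 < p := by linarith
  have h1 : 1 ≤ 2 / p := (one_le_div hp0).2 hp2
  have h2 : 2 / p ≤ 2 := (div_le_iff₀ hp0).2 (by linarith)
  have h := Real.geom_mean_le_arith_mean2_weighted (w₁ := 2 / p - 1) (w₂ := 2 - 2 / p)
    (p₁ := x ^ p) (p₂ := x ^ (p / 2) * y ^ (p / 2)) (by linarith) (by linarith) (by positivity)
    (by positivity) (by ring)
  refine le_trans (le_of_eq ?_) h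
  rw [Real.mul_rpow (by positivity) (by positivity), ← Real.rpow_mul hx.le, ← Real.rpow_mul hx.le,
    ← Real.rpow_mul hy.le, ← mul_assoc, ← Real.rpow_add hx]
  have e1 : p * (2 / p - 1) + p / 2 * (2 - 2 / p) = 1 := by field_simp; ring
  have e2 : p / 2 * (2 - 2 / p) = p - 1 := by field_simp
  rw [e1, e2, Real.rpow_one]

/-- The entropy dissipation between two states dominates a Dirichlet form. For `p > 1` this is
convexity of `λ ↦ A ^ λ * B ^ (2 - λ)` on `[1, 2]`, at `λ = 2 / p`, with `A = x ^ (p / 2)` and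
`B = y ^ (p / 2)`. -/
theorem two_mul_sq_le_mul_dPhi {p : ℝ} (hp : 1 ≤ p) (hp2 : p ≤ 2) {x y : ℝ} (hx : 0 < x)
    (hy : 0 < y) :
    2 * (x ^ (p / 2) - y ^ (p / 2)) ^ 2 ≤ (x - y) * (dPhi p x - dPhi p y) := by
  rcases hp.eq_or_lt with rfl | hp
  · wlog hxy : y ≤ x generalizing x y
    · have := this hy hx (le_of_not_ge hxy)
      linarith
    simp only [dPhi, if_true]
    have ex : x = (x ^ (1 / 2 : ℝ)) ^ 2 := by rw [← Real.sqrt_eq_rpow, Real.sq_sqrt hx.le]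
    have ey : y = (y ^ (1 / 2 : ℝ)) ^ 2 := by rw [← Real.sqrt_eq_rpow, Real.sq_sqrt hy.le]
    have ha : 0 < x ^ (1 / 2 : ℝ) := by positivity
    have hb : 0 < y ^ (1 / 2 : ℝ) := by positivity
    have hab : y ^ (1 / 2 : ℝ) ≤ x ^ (1 / 2 : ℝ) := Real.rpow_le_rpow hy.le hxy (by norm_num)
    set a := x ^ (1 / 2 : ℝ)
    set b := y ^ (1 / 2 : ℝ)
    have h1 := Real.log_le_sub_one_of_pos (show 0 < b / a by positivity)
    rw [Real.log_div hb.ne' ha.ne'] at h1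
    have h2 : Real.log x = 2 * Real.log a := by rw [ex, Real.log_pow]; norm_num
    have h3 : Real.log y = 2 * Real.log b := by rw [ey, Real.log_pow]; norm_num
    rw [h2, h3, ex, ey]
    have h4 : (a - b) / a ≤ Real.log a - Real.log b := by
      have : (a - b) / a = 1 - b / a := by field_simp
      linarith
    have h5 : 0 ≤ a ^ 2 - b ^ 2 := by nlinarith
    have h6 : (a - b) ^ 2 ≤ (a ^ 2 - b ^ 2) * ((a - b) / a) := by
      rw [mul_div_assoc', le_div_iff₀ ha]
      nlinarith [mul_nonneg (sq_nonneg (a - b)) hb.le]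
    nlinarith [mul_le_mul_of_nonneg_left h4 h5]
  · have h1 := rpow_mul_sub_le hp hp2 hx hy
    have h2 := rpow_mul_sub_le hp hp2 hy hx
    have hp0 : 0 < p - 1 := by linarith
    have ex : x ^ p = x * x ^ (p - 1) := by
      rw [Real.rpow_sub_one hx.ne']; field_simp
    have ey : y ^ p = y * y ^ (p - 1) := by
      rw [Real.rpow_sub_one hy.ne']; field_simp
    have ex2 : x ^ p = (x ^ (p / 2)) ^ 2 := by
      rw [← Real.rpow_natCast, ← Real.rpow_mul hx.le]; norm_num
    have ey2 : y ^ p = (y ^ (p / 2)) ^ 2 := by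
      rw [← Real.rpow_natCast, ← Real.rpow_mul hy.le]; norm_num
    have h3 : (2 - 2 / p) * (x ^ (p / 2) - y ^ (p / 2)) ^ 2
        ≤ (x - y) * (x ^ (p - 1) - y ^ (p - 1)) := by
      have e : (x - y) * (x ^ (p - 1) - y ^ (p - 1))
          = x ^ p + y ^ p - (x * y ^ (p - 1) + y * x ^ (p - 1)) := by rw [ex, ey]; ring
      rw [e]
      rw [ex2] at h1 ⊢
      rw [ey2] at h2 ⊢
      linarith
    have h4 := mul_le_mul_of_nonneg_left h3 (by positivity : 0 ≤ p / (p - 1))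
    simp only [dPhi, if_neg hp.ne']
    calc 2 * (x ^ (p / 2) - y ^ (p / 2)) ^ 2
        = p / (p - 1) * ((2 - 2 / p) * (x ^ (p / 2) - y ^ (p / 2)) ^ 2) := by field_simp
      _ ≤ _ := h4
      _ = _ := by ring

/-- The pointwise bound behind the Beckner inequality: for `t = c ^ (2 / p)` it bounds the
remainder of the tangent to `v ↦ v ^ p` at `t`. -/
theorem rpow_sub_tangent_le_sq {p : ℝ} (hp : 1 < p) (hp2 : p ≤ 2) {v c : ℝ} (hv : 0 < v)
    (hc : 0 < c) :
    v ^ p - c ^ 2 - p * (c ^ (2 / p)) ^ (p - 1) * (v - c ^ (2 / p)) ≤ (v ^ (p / 2) - c) ^ 2 := by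
  have hp0 : 0 < p := by linarith
  have h1 : 1 ≤ 2 / p := (one_le_div hp0).2 hp2
  have hz : 0 < v ^ (p / 2) := by positivity
  have h := rpow_tangent_le h1 hz.le hc
  have e1 : (v ^ (p / 2)) ^ (2 / p) = v := by
    rw [← Real.rpow_mul hv.le, show p / 2 * (2 / p) = 1 by field_simp, Real.rpow_one]
  have e2 : v ^ p = (v ^ (p / 2)) ^ 2 := by
    rw [← Real.rpow_natCast, ← Real.rpow_mul hv.le]; norm_num
  rw [e1] at h
  have e3 : (c ^ (2 / p)) ^ (p - 1) * c ^ (2 / p - 1) = c := by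
    rw [← Real.rpow_mul hc.le, ← Real.rpow_add hc,
      show 2 / p * (p - 1) + (2 / p - 1) = 1 by field_simp; ring, Real.rpow_one]
  have hq : 0 ≤ p * (c ^ (2 / p)) ^ (p - 1) := by positivity
  have h2 := mul_le_mul_of_nonneg_left h hq
  have e4 : p * (c ^ (2 / p)) ^ (p - 1) * (2 / p * c ^ (2 / p - 1) * (v ^ (p / 2) - c))
      = 2 * c * (v ^ (p / 2) - c) := by
    calc _ = (p * (2 / p)) * ((c ^ (2 / p)) ^ (p - 1) * c ^ (2 / p - 1)) * (v ^ (p / 2) - c) := by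
          ring
      _ = _ := by rw [e3]; field_simp
  rw [mul_add, e4] at h2
  rw [e2]
  linarith

/-- The pointwise bound behind the logarithmic Sobolev inequality. -/
theorem mul_log_sub_le_of_sq {f c s : ℝ} (hf : 0 < f) (hs : 0 < s) :
    f ^ 2 * Real.log (f ^ 2) - f ^ 2 * Real.log (c ^ 2 + s) - f ^ 2 + (c ^ 2 + s)
      ≤ 12 * (f - c) ^ 2 + 3 * (f - c) ^ 4 / s + 3 * s := by
  set t := c ^ 2 + s with ht
  have ht0 : 0 < t := by positivity
  have h1 := Real.log_le_sub_one_of_pos (show 0 < f ^ 2 / t by positivity)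
  rw [Real.log_div (by positivity) ht0.ne'] at h1
  have h2 := mul_le_mul_of_nonneg_left h1 (sq_nonneg f)
  have h3 : f ^ 2 * (f ^ 2 / t - 1) - f ^ 2 + t = (f ^ 2 - t) ^ 2 / t := by field_simp; ring
  have h4 : (f ^ 2 - t) ^ 2 ≤ 12 * c ^ 2 * (f - c) ^ 2 + 3 * (f - c) ^ 4 + 3 * s ^ 2 := by
    have e : f ^ 2 - t = 2 * c * (f - c) + (f - c) ^ 2 - s := by rw [ht]; ring
    rw [e]
    nlinarith [sq_nonneg (2 * c * (f - c) - (f - c) ^ 2), sq_nonneg (2 * c * (f - c) + s),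
      sq_nonneg ((f - c) ^ 2 + s)]
  have h5 : (f ^ 2 - t) ^ 2 / t ≤ 12 * (f - c) ^ 2 + 3 * (f - c) ^ 4 / s + 3 * s := by
    rw [div_le_iff₀ ht0]
    have h6 : 3 * (f - c) ^ 4 ≤ 3 * (f - c) ^ 4 / s * t := by
      rw [div_mul_eq_mul_div, le_div_iff₀ hs]
      exact mul_le_mul_of_nonneg_left (by rw [ht]; nlinarith [sq_nonneg c]) (by positivity)
    have h7 : 12 * c ^ 2 * (f - c) ^ 2 ≤ 12 * (f - c) ^ 2 * t := by
      rw [ht]; nlinarith [mul_nonneg (sq_nonneg (f - c)) hs.le]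
    have h8 : 3 * s ^ 2 ≤ 3 * s * t := by rw [ht]; nlinarith [mul_nonneg hs.le (sq_nonneg c)]
    linarith
  linarith

/-- An entropy production inequality for the implicit Euler scheme gives the two forms of
exponential decay. -/
theorem decaysAtRate_of_step {e : ℕ → ℝ} {Δt ν : ℝ} (he : 0 ≤ e 0) (hΔ : 0 < Δt) (hν : 0 < ν)
    (h : ∀ n, (1 + ν * Δt) * e (n + 1) ≤ e n) : DecaysAtRate e Δt ν := by
  have hpos : 0 < 1 + ν * Δt := by positivity
  have h1 : ∀ n : ℕ, e n ≤ (1 + ν * Δt) ^ (-(n : ℤ)) * e 0 := by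
    intro n
    rw [zpow_neg, zpow_natCast, ← div_eq_inv_mul, le_div_iff₀ (by positivity)]
    induction n with
    | zero => simp
    | succ n ih =>
      calc e (n + 1) * (1 + ν * Δt) ^ (n + 1)
          = (1 + ν * Δt) * e (n + 1) * (1 + ν * Δt) ^ n := by ring
        _ ≤ e n * (1 + ν * Δt) ^ n := mul_le_mul_of_nonneg_right (h n) (by positivity)
        _ ≤ e 0 := ih
  refine ⟨h1, fun k hk hΔk n => (h1 n).trans (mul_le_mul_of_nonneg_right ?_ he)⟩
  have hb := rpow_one_add_le_one_add_mul_self (s := ν * k) (p := Δt / k)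
    (by have : 0 < ν * k := by positivity
        linarith) (by positivity) ((div_le_one hk).2 hΔk)
  have e1 : Δt / k * (ν * k) = ν * Δt := by field_simp
  rw [e1] at hb
  have hb0 : 0 < (1 + ν * k) ^ (Δt / k) := by positivity
  have hlog := Real.log_le_log hb0 hb
  rw [Real.log_rpow (by positivity)] at hlog
  rw [← Real.exp_log (show 0 < (1 + ν * Δt) ^ (-(n : ℤ)) by positivity), Real.exp_le_exp,
    Real.log_zpow]
  have h2 := mul_le_mul_of_nonneg_left hlog (Nat.cast_nonneg (α := ℝ) n)
  push_cast
  calc -(n : ℝ) * Real.log (1 + ν * Δt) ≤ -(n * (Δt / k * Real.log (1 + ν * k))) := by linarith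
    _ = _ := by ring

/-! ### Segments, convex sets and triangles in the plane -/

/-- The determinant of two vectors of the plane. -/
noncomputable def planeDet (u v : Plane) : ℝ := u 0 * v 1 - u 1 * v 0

theorem dist_sq_eq (x y : Plane) : dist x y ^ 2 = (x 0 - y 0) ^ 2 + (x 1 - y 1) ^ 2 := by
  rw [EuclideanSpace.dist_eq, Real.sq_sqrt (Finset.sum_nonneg fun _ _ => sq_nonneg _)]
  simp [Fin.sum_univ_two, Real.dist_eq, sq_abs]

/-- The orthogonal projection of `x` onto the line through `a ≠ b` is at the distance
`|det (b - a, x - a)| / |b - a|` from `x`. -/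
theorem exists_mem_line_dist_mul {a b : Plane} (hab : a ≠ b) (x : Plane) :
    ∃ y ∈ (line[ℝ, a, b] : AffineSubspace ℝ Plane),
      dist a b * dist x y = |planeDet (b - a) (x - a)| := by
  have hd : 0 < dist a b := dist_pos.2 hab
  have hd2 := dist_sq_eq a b
  have hd0 : 0 < (a 0 - b 0) ^ 2 + (a 1 - b 1) ^ 2 := by rw [← hd2]; positivity
  set N := (a 0 - b 0) ^ 2 + (a 1 - b 1) ^ 2 with hN
  set τ := ((x 0 - a 0) * (b 0 - a 0) + (x 1 - a 1) * (b 1 - a 1)) / N with hτ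
  refine ⟨AffineMap.lineMap a b τ, AffineMap.lineMap_mem_affineSpan_pair _ _ _, ?_⟩
  have hτN : τ * N = (x 0 - a 0) * (b 0 - a 0) + (x 1 - a 1) * (b 1 - a 1) := by
    rw [hτ]; field_simp
  rw [← abs_of_nonneg (mul_nonneg hd.le dist_nonneg : 0 ≤ dist a b * dist x _),
    ← sq_eq_sq_iff_abs_eq_abs,
    mul_pow, dist_sq_eq, dist_sq_eq, ← hN]
  simp only [AffineMap.lineMap_apply, vsub_eq_sub, vadd_eq_add, PiLp.add_apply, PiLp.smul_apply,
    PiLp.sub_apply, smul_eq_mul, planeDet]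
  have e : N * ((x 0 - (τ * (b 0 - a 0) + a 0)) ^ 2 + (x 1 - (τ * (b 1 - a 1) + a 1)) ^ 2)
      = N * ((x 0 - a 0) ^ 2 + (x 1 - a 1) ^ 2)
        - 2 * (τ * N) * ((x 0 - a 0) * (b 0 - a 0) + (x 1 - a 1) * (b 1 - a 1))
        + (τ * N) ^ 2 := by
    rw [hN]; ring
  rw [e, hτN, hN]
  ring

theorem mem_line_of_planeDet_eq_zero {a b x : Plane} (hab : a ≠ b)
    (h : planeDet (b - a) (x - a) = 0) : x ∈ (line[ℝ, a, b] : AffineSubspace ℝ Plane) := by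
  obtain ⟨y, hy, hxy⟩ := exists_mem_line_dist_mul hab x
  rw [h, abs_zero, mul_eq_zero, or_iff_right (dist_pos.2 hab).ne', dist_eq_zero] at hxy
  rwa [hxy]

theorem dist_mul_infDist_line_le {a b : Plane} (hab : a ≠ b) (x : Plane) :
    dist a b * Metric.infDist x (line[ℝ, a, b] : Set Plane) ≤ |planeDet (b - a) (x - a)| := by
  obtain ⟨y, hy, hxy⟩ := exists_mem_line_dist_mul hab x
  rw [← hxy]
  exact mul_le_mul_of_nonneg_left (Metric.infDist_le_dist_of_mem hy) dist_nonneg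

/-- A point of an open convex set is not on the line through a segment contained in its
frontier. -/
theorem planeDet_ne_zero_of_mem {K : Set Plane} (hK : IsOpen K) (hKc : Convex ℝ K) {a b x : Plane}
    (hab : a ≠ b) (hcl : segment ℝ a b ⊆ closure K) (hdisj : Disjoint K (segment ℝ a b))
    (hx : x ∈ K) : planeDet (b - a) (x - a) ≠ 0 := by
  intro h
  obtain ⟨τ, rfl⟩ := mem_affineSpan_pair_iff_exists_lineMap_eq.1 (mem_line_of_planeDet_eq_zero hab h)
  have hint : AffineMap.lineMap a b τ ∈ interior K := by rwa [hK.interior_eq]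
  have ha : a ∈ segment ℝ a b := left_mem_segment ℝ a b
  have hb : b ∈ segment ℝ a b := right_mem_segment ℝ a b
  rcases lt_or_ge τ 0 with h0 | h0
  · have hτ : 0 < 1 - τ := by linarith
    have := hKc.combo_interior_closure_mem_interior hint (hcl hb) (a := 1 / (1 - τ))
      (b := -τ / (1 - τ)) (by positivity) (div_nonneg (by linarith) hτ.le) (by field_simp; ring)
    have e : (1 / (1 - τ)) • AffineMap.lineMap a b τ + (-τ / (1 - τ)) • b = a := by
      rw [AffineMap.lineMap_apply_module, smul_add, smul_smul, smul_smul, add_assoc, ← add_smul]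
      have e1 : 1 / (1 - τ) * (1 - τ) = 1 := by field_simp
      have e2 : 1 / (1 - τ) * τ + -τ / (1 - τ) = 0 := by field_simp; ring
      rw [e1, e2, one_smul, zero_smul, add_zero]
    rw [e, hK.interior_eq] at this
    exact Set.disjoint_left.1 hdisj this ha
  · rcases le_or_gt τ 1 with h1 | h1
    · refine Set.disjoint_left.1 hdisj hx ⟨1 - τ, τ, by linarith, h0, by ring, ?_⟩
      rw [AffineMap.lineMap_apply_module]
    · have := hKc.combo_interior_closure_mem_interior hint (hcl ha) (a := 1 / τ)
        (b := (τ - 1) / τ) (by positivity) (div_nonneg (by linarith) h0) (by field_simp; ring)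
      have e : (1 / τ) • AffineMap.lineMap a b τ + ((τ - 1) / τ) • a = b := by
        rw [AffineMap.lineMap_apply_module, smul_add, smul_smul, smul_smul, add_right_comm,
          ← add_smul]
        have e1 : 1 / τ * (1 - τ) + (τ - 1) / τ = 0 := by field_simp; ring
        have e2 : 1 / τ * τ = 1 := by field_simp
        rw [e1, e2, one_smul, zero_smul, zero_add]
      rw [e, hK.interior_eq] at this
      exact Set.disjoint_left.1 hdisj this hb

/-- Two open convex sets which touch a segment from the same side intersect. -/
theorem inter_nonempty_of_planeDet_mul_pos {K L : Set Plane} (hK : IsOpen K) (hKc : Convex ℝ K)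
    (hL : IsOpen L) (hLc : Convex ℝ L) {a b x y : Plane} (haK : segment ℝ a b ⊆ closure K)
    (haL : segment ℝ a b ⊆ closure L) (hx : x ∈ K) (hy : y ∈ L)
    (h : 0 < planeDet (b - a) (x - a) * planeDet (b - a) (y - a)) : (K ∩ L).Nonempty := by
  set Dx := planeDet (b - a) (x - a) with hDx
  set Dy := planeDet (b - a) (y - a) with hDy
  have hDx0 : Dx ≠ 0 := left_ne_zero_of_mul h.ne'
  -- the coordinates of `y` in the frame `(a, b - a, x - a)`
  set y₁ := planeDet (y - a) (x - a) / Dx with hy₁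
  set y₂ := Dy / Dx with hy₂
  have hy₂0 : 0 < y₂ := by
    have e : Dy / Dx = Dx * Dy / Dx ^ 2 := by field_simp
    rw [hy₂, e]; positivity
  have hyeq : y = a + y₁ • (b - a) + y₂ • (x - a) := by
    have e₁ : Dx * y₁ = planeDet (y - a) (x - a) := mul_div_cancel₀ _ hDx0
    have e₂ : Dx * y₂ = Dy := mul_div_cancel₀ _ hDx0
    have key : ∀ i, Dx * y i = Dx * a i + Dx * y₁ * (b i - a i) + Dx * y₂ * (x i - a i) := by
      rw [e₁, e₂, hDx, hDy]
      simp only [planeDet, PiLp.sub_apply]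
      intro i
      fin_cases i
      · simp only [Fin.zero_eta]; ring
      · simp only [Fin.mk_one]; ring
    ext i
    apply mul_left_cancel₀ hDx0
    rw [key i]
    simp only [PiLp.add_apply, PiLp.smul_apply, PiLp.sub_apply, smul_eq_mul]
    ring
  -- for this weight of `y` the corresponding points of the segment lie near its midpoint
  set α := 1 / (4 * (1 + |y₁| + y₂)) with hα
  have hα0 : 0 < α := by positivity
  have hden : 0 < 1 + |y₁| + y₂ := by positivity
  have hαe : α * (1 + |y₁| + y₂) = 1 / 4 := by rw [hα]; field_simp
  have hαy : α * y₁ ≤ α * |y₁| := mul_le_mul_of_nonneg_left (le_abs_self _) hα0.le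
  have hαy' : -(α * |y₁|) ≤ α * y₁ := by
    have := mul_le_mul_of_nonneg_left (neg_abs_le y₁) hα0.le
    linarith
  have p1 : 0 < α * y₂ := by positivity
  have p2 : 0 ≤ α * |y₁| := by positivity
  have p3 : α + α * |y₁| + α * y₂ = 1 / 4 := by rw [← hαe]; ring
  have hd1 : 0 < 1 - α * y₂ := by linarith
  set l := (α * y₁ + (1 - α) / 2) / (1 - α * y₂) with hl
  have hl0 : 0 ≤ l := div_nonneg (by linarith) hd1.le
  have hl1 : l ≤ 1 := (div_le_one hd1).2 (by linarith)
  have hle : l * (1 - α * y₂) = α * y₁ + (1 - α) / 2 := by rw [hl]; field_simp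
  have h1 := hKc.combo_interior_closure_mem_interior (by rwa [hK.interior_eq])
    (haK ⟨1 - l, l, by linarith, hl0, by ring, rfl⟩) p1 hd1.le (by ring) (x := x)
  have h2 := hLc.combo_interior_closure_mem_interior (by rwa [hL.interior_eq])
    (haL ⟨1 / 2, 1 / 2, by norm_num, by norm_num, by norm_num, rfl⟩) hα0
    (by linarith : 0 ≤ 1 - α) (by ring) (x := y)
  rw [hK.interior_eq] at h1
  rw [hL.interior_eq] at h2
  refine ⟨_, h1, ?_⟩
  convert h2 using 1
  rw [hyeq]
  have e : (α * y₂) • x + (1 - α * y₂) • ((1 - l) • a + l • b)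
      = (α * y₂) • x + (1 - α * y₂) • a + (l * (1 - α * y₂)) • (b - a) := by module
  rw [e, hle]
  module

/-- The open reference triangle. -/
def refTriangle : Set Plane := {z | 0 < z 0 ∧ 0 < z 1 ∧ z 0 + z 1 < 1}

theorem refTriangle_isOpen : IsOpen refTriangle := by
  have h0 : Continuous fun z : Plane => z 0 := by fun_prop
  have h1 : Continuous fun z : Plane => z 1 := by fun_prop
  exact (isOpen_lt continuous_const h0).inter
    ((isOpen_lt continuous_const h1).inter (isOpen_lt (h0.add h1) continuous_const))

theorem refTriangle_convex : Convex ℝ refTriangle := by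
  rintro x ⟨hx0, hx1, hx2⟩ y ⟨hy0, hy1, hy2⟩ s t hs ht hst
  simp only [refTriangle, mem_ofPred_eq, PiLp.add_apply, PiLp.smul_apply, smul_eq_mul]
  rcases hs.eq_or_lt with rfl | hs
  · obtain rfl : t = 1 := by linarith
    simpa using ⟨hy0, hy1, hy2⟩
  · have hst' : t = 1 - s := by linarith
    refine ⟨by positivity, by positivity, ?_⟩
    nlinarith [mul_pos hs (sub_pos.2 hx2), mul_nonneg ht (sub_pos.2 hy2).le]

theorem refTriangle_volume_pos : 0 < volume.real refTriangle := by
  refine volume_real_pos_of_isOpen refTriangle_isOpen ⟨!₂[1 / 4, 1 / 4], ?_⟩ ?_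
  · simp [refTriangle]; norm_num
  · have hb : refTriangle ⊆ Metric.closedBall 0 2 := by
      rintro z ⟨h0, h1, h2⟩
      rw [Metric.mem_closedBall]
      have := dist_sq_eq z 0
      simp only [PiLp.zero_apply, sub_zero] at this
      have h3 : dist z 0 ^ 2 ≤ 2 ^ 2 := by rw [this]; nlinarith
      exact le_of_sq_le_sq h3 (by norm_num)
    exact (Metric.isBounded_closedBall.subset hb).measure_lt_top.ne

/-- The open triangle with vertices `x`, `a`, `b`. -/
def openTriangle (x a b : Plane) : Set Plane :=
  (fun z : Plane => x + (z 0 • (a - x) + z 1 • (b - x))) '' refTriangle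

theorem exists_linearMap_det (u v : Plane) :
    ∃ f : Plane →ₗ[ℝ] Plane, (∀ z : Plane, f z = z 0 • u + z 1 • v) ∧
      LinearMap.det f = planeDet u v := by
  let f : Plane →ₗ[ℝ] Plane :=
    { toFun := fun z => z 0 • u + z 1 • v
      map_add' := fun z z' => by simp only [PiLp.add_apply]; module
      map_smul' := fun r z => by
        simp only [PiLp.smul_apply, smul_eq_mul, RingHom.id_apply]; module }
  refine ⟨f, fun z => rfl, ?_⟩
  rw [← LinearMap.det_toMatrix (EuclideanSpace.basisFun (Fin 2) ℝ).toBasis, Matrix.det_fin_two]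
  simp [LinearMap.toMatrix_apply, f, planeDet]
  ring

theorem volume_real_openTriangle (x a b : Plane) :
    volume.real (openTriangle x a b) = |planeDet (a - x) (b - x)| * volume.real refTriangle := by
  obtain ⟨f, hf, hdet⟩ := exists_linearMap_det (a - x) (b - x)
  have h1 : openTriangle x a b = (fun z => x + z) '' (f '' refTriangle) := by
    rw [image_image]
    simp only [hf, openTriangle]
  rw [h1, Measure.real, Set.image_add_left, measure_preimage_add,
    Measure.addHaar_image_linearMap, hdet, ENNReal.toReal_mul,
    ENNReal.toReal_ofReal (abs_nonneg _)]
  rfl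

theorem convex_openTriangle (x a b : Plane) : Convex ℝ (openTriangle x a b) := by
  obtain ⟨f, hf, -⟩ := exists_linearMap_det (a - x) (b - x)
  have h1 : openTriangle x a b = (fun z => x + z) '' (f '' refTriangle) := by
    rw [image_image]
    simp only [hf, openTriangle]
  rw [h1]
  exact (refTriangle_convex.linear_image f).translate x

/-- Polar coordinates with respect to the vertex `x`. -/
theorem exists_of_mem_openTriangle {x a b p : Plane} (hp : p ∈ openTriangle x a b) :
    ∃ (r : ℝ) (y : Plane), 0 < r ∧ r < 1 ∧ y ∈ segment ℝ a b ∧ p = (1 - r) • x + r • y := by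
  obtain ⟨z, ⟨h0, h1, h2⟩, rfl⟩ := hp
  have hr : 0 < z 0 + z 1 := by linarith
  refine ⟨z 0 + z 1, (z 0 / (z 0 + z 1)) • a + (z 1 / (z 0 + z 1)) • b, hr, h2,
    ⟨_, _, by positivity, by positivity, by field_simp, rfl⟩, ?_⟩
  rw [smul_add, smul_smul, smul_smul, mul_div_cancel₀ (z 0) hr.ne', mul_div_cancel₀ (z 1) hr.ne']
  module

/-! ### Geometry of admissible meshes -/

namespace AdmissibleMesh

variable {Ω : Set Plane} {T E : Type} (𝔐 : AdmissibleMesh Ω T E)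

theorem isOpen_cell (K : T) : IsOpen (𝔐.cell K) := by
  obtain ⟨s, hs⟩ := 𝔐.cell_polygon K
  rw [hs]; exact isOpen_interior

theorem convex_cell (K : T) : Convex ℝ (𝔐.cell K) := by
  obtain ⟨s, hs⟩ := 𝔐.cell_polygon K
  rw [hs]; exact (convex_convexHull ℝ _).interior

theorem isBounded_cell (K : T) : Bornology.IsBounded (𝔐.cell K) := by
  obtain ⟨s, hs⟩ := 𝔐.cell_polygon K
  rw [hs]
  exact (isBounded_convexHull.2 s.finite_toSet.isBounded).subset interior_subset

theorem area_pos (K : T) : 0 < 𝔐.area K :=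
  volume_real_pos_of_isOpen (𝔐.isOpen_cell K) ⟨_, 𝔐.center_mem K⟩
    (𝔐.isBounded_cell K).measure_lt_top.ne

theorem isCellPartition [Finite T] : IsCellPartition Ω 𝔐.cell where
  isOpen := 𝔐.isOpen_cell
  isBounded := 𝔐.isBounded_cell
  subset := 𝔐.cell_subset
  disjoint := 𝔐.cell_disjoint
  subset_closure := by
    rw [← closure_iUnion_of_finite, 𝔐.closure_iUnion_cell]
    exact subset_closure
  volume_diff := by
    refine measure_mono_null (t := ⋃ K, frontier (𝔐.cell K)) (fun x hx => ?_)
      (measure_iUnion_null fun K => (𝔐.convex_cell K).addHaar_frontier volume)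
    have hx' : x ∈ ⋃ K, closure (𝔐.cell K) := by
      rw [← closure_iUnion_of_finite, 𝔐.closure_iUnion_cell]
      exact subset_closure hx.1
    obtain ⟨K, hK⟩ := mem_iUnion.1 hx'
    refine mem_iUnion.2 ⟨K, hK, fun h => hx.2 (mem_iUnion.2 ⟨K, ?_⟩)⟩
    rwa [(𝔐.isOpen_cell K).interior_eq] at h

theorem nonempty_cells {Ω : Set Plane} {T E : Type} [Finite T] (𝔐 : AdmissibleMesh Ω T E)
    (hΩ : Ω.Nonempty) : Nonempty T := by
  obtain ⟨x, hx⟩ := hΩ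
  obtain ⟨K, -⟩ := mem_iUnion.1 (𝔐.isCellPartition.subset_closure hx)
  exact ⟨K⟩

theorem sum_area [Fintype T] : ∑ K, 𝔐.area K = volume.real Ω := by
  rw [← 𝔐.isCellPartition.sum_volume_inter subset_rfl]
  refine Finset.sum_congr rfl fun K _ => ?_
  rw [inter_eq_left.2 (𝔐.cell_subset K)]; rfl

theorem disjoint_frontier (K : T) : Disjoint (𝔐.cell K) (frontier (𝔐.cell K)) := by
  rw [(𝔐.isOpen_cell K).frontier_eq]
  exact disjoint_sdiff_self_right

/-- The side of the line through the edge `σ` on which the center of `K` lies, as the sign of a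
determinant. -/
noncomputable def sideDet (K : T) (σ : E) : ℝ :=
  planeDet (𝔐.snd σ - 𝔐.fst σ) (𝔐.center K - 𝔐.fst σ)

theorem sideDet_ne_zero {K : T} {σ : E} (h : 𝔐.edge σ ⊆ frontier (𝔐.cell K)) :
    𝔐.sideDet K σ ≠ 0 :=
  planeDet_ne_zero_of_mem (𝔐.isOpen_cell K) (𝔐.convex_cell K) (𝔐.fst_ne_snd σ)
    (h.trans frontier_subset_closure) ((𝔐.disjoint_frontier K).mono_right h) (𝔐.center_mem K)

theorem length_pos (σ : E) : 0 < 𝔐.length σ := dist_pos.2 (𝔐.fst_ne_snd σ)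

theorem length_mul_distEdge_le (K : T) (σ : E) :
    𝔐.length σ * 𝔐.distEdge K σ ≤ |𝔐.sideDet K σ| :=
  dist_mul_infDist_line_le (𝔐.fst_ne_snd σ) (𝔐.center K)

theorem distEdge_nonneg (K : T) (σ : E) : 0 ≤ 𝔐.distEdge K σ := Metric.infDist_nonneg

theorem distEdge_pos {K : T} {σ : E} (h : 𝔐.edge σ ⊆ frontier (𝔐.cell K)) :
    0 < 𝔐.distEdge K σ := by
  have hne : ((line[ℝ, 𝔐.fst σ, 𝔐.snd σ] : AffineSubspace ℝ Plane) : Set Plane).Nonempty :=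
    ⟨_, left_mem_affineSpan_pair ℝ _ _⟩
  refine ((AffineSubspace.closed_of_finiteDimensional _).notMem_iff_infDist_pos hne).1
    fun hmem => 𝔐.sideDet_ne_zero h ?_
  obtain ⟨τ, hτ⟩ := mem_affineSpan_pair_iff_exists_lineMap_eq.1 hmem
  rw [sideDet, ← hτ]
  simp only [planeDet, AffineMap.lineMap_apply, vsub_eq_sub, vadd_eq_add, PiLp.add_apply,
    PiLp.smul_apply, PiLp.sub_apply, smul_eq_mul]
  ring

namespace IsInterface

variable {𝔐} {K L L' : T} {σ : E}

theorem symm (h : 𝔐.IsInterface K L σ) : 𝔐.IsInterface L K σ :=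
  ⟨h.1.symm, by rw [inter_comm]; exact h.2⟩

theorem edge_subset_closure (h : 𝔐.IsInterface K L σ) : 𝔐.edge σ ⊆ closure (𝔐.cell K) := by
  rw [← h.2]; exact inter_subset_left

theorem edge_subset_frontier (h : 𝔐.IsInterface K L σ) : 𝔐.edge σ ⊆ frontier (𝔐.cell K) := by
  rw [(𝔐.isOpen_cell K).frontier_eq]
  intro x hx
  refine ⟨h.edge_subset_closure hx, fun hxK => ?_⟩
  exact Set.disjoint_left.1 ((𝔐.cell_disjoint K L h.1).closure_right (𝔐.isOpen_cell K)) hxK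
    (h.symm.edge_subset_closure hx)

theorem sideDet_mul_neg (h : 𝔐.IsInterface K L σ) : 𝔐.sideDet K σ * 𝔐.sideDet L σ < 0 := by
  refine lt_of_le_of_ne (not_lt.1 fun hpos => ?_) (mul_ne_zero
    (𝔐.sideDet_ne_zero h.edge_subset_frontier) (𝔐.sideDet_ne_zero h.symm.edge_subset_frontier))
  obtain ⟨x, hx, hx'⟩ := inter_nonempty_of_planeDet_mul_pos (𝔐.isOpen_cell K) (𝔐.convex_cell K)
    (𝔐.isOpen_cell L) (𝔐.convex_cell L) h.edge_subset_closure h.symm.edge_subset_closure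
    (𝔐.center_mem K) (𝔐.center_mem L) hpos
  exact Set.disjoint_left.1 (𝔐.cell_disjoint K L h.1) hx hx'

/-- An edge separates at most two cells: two of three cells would lie on the same side of it. -/
theorem unique (h : 𝔐.IsInterface K L σ) (h' : 𝔐.IsInterface K L' σ) : L = L' := by
  by_contra hne
  have h'' : 𝔐.IsInterface L L' σ := by
    refine ⟨hne, ?_⟩
    rcases 𝔐.inter_cells L L' hne with hs | ⟨σ', hσ'⟩
    · exact absurd (hs ⟨h.symm.edge_subset_closure (left_mem_segment ℝ _ _),
        h'.symm.edge_subset_closure (left_mem_segment ℝ _ _)⟩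
        ⟨h.symm.edge_subset_closure (right_mem_segment ℝ _ _),
        h'.symm.edge_subset_closure (right_mem_segment ℝ _ _)⟩) (𝔐.fst_ne_snd σ)
    · have hsub : 𝔐.edge σ ⊆ 𝔐.edge σ' := by
        rw [edge, edge, ← hσ']
        exact subset_inter h.symm.edge_subset_closure h'.symm.edge_subset_closure
      by_cases hσ : σ = σ'
      · rw [hσ]; exact hσ'
      · exact absurd (𝔐.edge_inter σ σ' hσ
          ⟨left_mem_segment ℝ _ _, hsub (left_mem_segment ℝ _ _)⟩
          ⟨right_mem_segment ℝ _ _, hsub (right_mem_segment ℝ _ _)⟩) (𝔐.fst_ne_snd σ)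
  have e1 := h.sideDet_mul_neg
  have e2 := h'.sideDet_mul_neg
  have e3 := h''.sideDet_mul_neg
  nlinarith [mul_pos_of_neg_of_neg e1 e2, sq_nonneg (𝔐.sideDet K σ),
    mul_nonneg (sq_nonneg (𝔐.sideDet K σ)) (neg_nonneg.2 e3.le)]

theorem nb_eq (h : 𝔐.IsInterface K L σ) : 𝔐.nb K σ = L := by
  have hex : ∃ L, 𝔐.IsInterface K L σ := ⟨L, h⟩
  rw [nb, dif_pos hex]
  exact hex.choose_spec.unique h

theorem dEdge_eq (h : 𝔐.IsInterface K L σ) :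
    𝔐.dEdge K σ = dist (𝔐.center K) (𝔐.center L) := by
  rw [dEdge, if_pos ⟨L, h⟩, h.nb_eq]

/-- The segment between the centers crosses the line through the common edge. -/
theorem distEdge_le (h : 𝔐.IsInterface K L σ) : 𝔐.distEdge K σ ≤ 𝔐.dEdge K σ := by
  rw [h.dEdge_eq]
  have hneg := h.sideDet_mul_neg
  set p := 𝔐.sideDet K σ with hp
  set q := 𝔐.sideDet L σ with hq
  have hpq : p - q ≠ 0 := fun h0 => by
    rw [sub_eq_zero] at h0; rw [h0] at hneg; nlinarith [mul_self_nonneg q]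
  have hθ0 : 0 ≤ p / (p - q) := by
    have e : p / (p - q) = (p ^ 2 - p * q) / (p - q) ^ 2 := by field_simp
    rw [e]; exact div_nonneg (by nlinarith) (sq_nonneg _)
  have hθ1 : p / (p - q) ≤ 1 := by
    have e : 1 - p / (p - q) = (q ^ 2 - p * q) / (p - q) ^ 2 := by field_simp; ring
    have : 0 ≤ (q ^ 2 - p * q) / (p - q) ^ 2 := div_nonneg (by nlinarith) (sq_nonneg _)
    linarith
  set θ := p / (p - q) with hθ
  have hzero : p + θ * (q - p) = 0 := by rw [hθ]; field_simp; ring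
  have hmem : AffineMap.lineMap (𝔐.center K) (𝔐.center L) θ ∈
      (line[ℝ, 𝔐.fst σ, 𝔐.snd σ] : AffineSubspace ℝ Plane) := by
    refine mem_line_of_planeDet_eq_zero (𝔐.fst_ne_snd σ) ?_
    rw [← hzero, hp, hq, sideDet, sideDet]
    simp only [planeDet, AffineMap.lineMap_apply, vsub_eq_sub, vadd_eq_add, PiLp.add_apply,
      PiLp.smul_apply, PiLp.sub_apply, smul_eq_mul]
    ring
  refine (Metric.infDist_le_dist_of_mem hmem).trans ?_
  rw [dist_left_lineMap, Real.norm_of_nonneg hθ0]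
  exact mul_le_of_le_one_left dist_nonneg hθ1

end IsInterface

theorem nb_eq_self {K : T} {σ : E} (h : ¬ ∃ L, 𝔐.IsInterface K L σ) : 𝔐.nb K σ = K := by
  rw [nb, dif_neg h]

theorem nb_nb (K : T) (σ : E) : 𝔐.nb (𝔐.nb K σ) σ = K := by
  by_cases h : ∃ L, 𝔐.IsInterface K L σ
  · obtain ⟨L, h⟩ := h
    rw [h.nb_eq, h.symm.nb_eq]
  · rw [𝔐.nb_eq_self h, 𝔐.nb_eq_self h]

theorem dEdge_nb (K : T) (σ : E) : 𝔐.dEdge (𝔐.nb K σ) σ = 𝔐.dEdge K σ := by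
  by_cases h : ∃ L, 𝔐.IsInterface K L σ
  · obtain ⟨L, h⟩ := h
    rw [h.nb_eq, h.symm.dEdge_eq, h.dEdge_eq, dist_comm]
  · rw [𝔐.nb_eq_self h]

theorem trans_nb (K : T) (σ : E) : 𝔐.trans (𝔐.nb K σ) σ = 𝔐.trans K σ := by
  rw [trans, trans, dEdge_nb]

theorem distEdge_le_dEdge (K : T) (σ : E) : 𝔐.distEdge K σ ≤ 𝔐.dEdge K σ := by
  by_cases h : ∃ L, 𝔐.IsInterface K L σ
  · obtain ⟨L, h⟩ := h
    exact h.distEdge_le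
  · rw [dEdge, if_neg h]

theorem dEdge_nonneg (K : T) (σ : E) : 0 ≤ 𝔐.dEdge K σ :=
  (𝔐.distEdge_nonneg K σ).trans (𝔐.distEdge_le_dEdge K σ)

theorem trans_nonneg (K : T) (σ : E) : 0 ≤ 𝔐.trans K σ :=
  div_nonneg (𝔐.length_pos σ).le (𝔐.dEdge_nonneg K σ)

/-- A ray from the center of a cell meets the boundary of the cell only once. -/
theorem eq_of_ray {K : T} {y y' : Plane} {r r' : ℝ} (hr : 0 < r) (hr' : 0 < r')
    (hy : y ∈ frontier (𝔐.cell K)) (hy' : y' ∈ frontier (𝔐.cell K))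
    (h : (1 - r) • 𝔐.center K + r • y = (1 - r') • 𝔐.center K + r' • y') : y = y' := by
  wlog hle : r ≤ r' generalizing r r' y y'
  · exact (this hr' hr hy' hy h.symm (le_of_not_ge hle)).symm
  rcases hle.eq_or_lt with rfl | hlt
  · exact smul_right_injective _ hr.ne' (add_left_cancel h)
  · exfalso
    have e : y' = (1 - r / r') • 𝔐.center K + (r / r') • y := by
      apply smul_right_injective _ hr'.ne'
      have e1 : r' * (1 - r / r') = r' - r := by field_simp
      have e2 : r' * (r / r') = r := by field_simp
      show r' • y' = r' • _
      rw [smul_add, smul_smul, smul_smul, e1, e2]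
      have e3 : r' • y' = ((1 - r) • 𝔐.center K + r • y) - (1 - r') • 𝔐.center K := by
        rw [h]; abel
      rw [e3]; module
    have hmem := (𝔐.convex_cell K).combo_interior_closure_mem_interior (x := 𝔐.center K) (y := y)
      (by rw [(𝔐.isOpen_cell K).interior_eq]; exact 𝔐.center_mem K)
      (frontier_subset_closure hy) (a := 1 - r / r') (b := r / r')
      (sub_pos.2 ((div_lt_one hr').2 hlt)) (by positivity) (by ring)
    rw [← e] at hmem
    exact hy'.2 hmem

section Fintype

variable [Fintype E]

theorem mem_edges {K : T} {σ : E} : σ ∈ 𝔐.edges K ↔ 𝔐.edge σ ⊆ frontier (𝔐.cell K) := by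
  simp [edges]

theorem mem_edges_nb {K : T} {σ : E} : σ ∈ 𝔐.edges (𝔐.nb K σ) ↔ σ ∈ 𝔐.edges K := by
  by_cases h : ∃ L, 𝔐.IsInterface K L σ
  · obtain ⟨L, h⟩ := h
    rw [h.nb_eq, mem_edges, mem_edges]
    exact iff_of_true h.symm.edge_subset_frontier h.edge_subset_frontier
  · rw [𝔐.nb_eq_self h]

/-- Sums over the pairs of a cell and one of its edges are invariant under passing to the other side
of the edges. -/
theorem sum_edges_nb [Fintype T] (F : T → E → ℝ) :
    ∑ K, ∑ σ ∈ 𝔐.edges K, F (𝔐.nb K σ) σ = ∑ K, ∑ σ ∈ 𝔐.edges K, F K σ := by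
  rw [Finset.sum_sigma', Finset.sum_sigma']
  refine Finset.sum_nbij' (fun x => ⟨𝔐.nb x.1 x.2, x.2⟩) (fun x => ⟨𝔐.nb x.1 x.2, x.2⟩)
    ?_ ?_ ?_ ?_ ?_
  · rintro ⟨K, σ⟩ h
    simpa [mem_edges_nb] using h
  · rintro ⟨K, σ⟩ h
    simpa [mem_edges_nb] using h
  · rintro ⟨K, σ⟩ -
    simp [nb_nb]
  · rintro ⟨K, σ⟩ -
    simp [nb_nb]
  · rintro ⟨K, σ⟩ -
    rfl

theorem dEdge_pos {K : T} {σ : E} (h : σ ∈ 𝔐.edges K) : 0 < 𝔐.dEdge K σ :=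
  (𝔐.distEdge_pos (𝔐.mem_edges.1 h)).trans_le (𝔐.distEdge_le_dEdge K σ)

theorem edges_nonempty (K : T) : (𝔐.edges K).Nonempty := by
  have hne : (frontier (𝔐.cell K)).Nonempty := by
    refine nonempty_frontier_iff.2 ⟨⟨_, 𝔐.center_mem K⟩, fun h => ?_⟩
    have := 𝔐.isBounded_cell K
    rw [h] at this
    exact NormedSpace.unbounded_univ ℝ Plane this
  rw [𝔐.frontier_cell K] at hne
  obtain ⟨x, hx⟩ := hne
  simp only [mem_iUnion] at hx
  obtain ⟨σ, hσ, -⟩ := hx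
  exact ⟨σ, 𝔐.mem_edges.2 hσ⟩

theorem IsRegular.le_one {ζ : ℝ} (h : 𝔐.IsRegular ζ) (K : T) : ζ ≤ 1 := by
  obtain ⟨σ, hσ⟩ := 𝔐.edges_nonempty K
  have h1 := (h K σ hσ).trans (𝔐.distEdge_le_dEdge K σ)
  exact (mul_le_iff_le_one_left (𝔐.dEdge_pos hσ)).1 h1

theorem openTriangle_subset {K : T} {σ : E} (h : σ ∈ 𝔐.edges K) :
    openTriangle (𝔐.center K) (𝔐.fst σ) (𝔐.snd σ) ⊆ 𝔐.cell K := by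
  intro p hp
  obtain ⟨r, y, hr, hr1, hy, rfl⟩ := exists_of_mem_openTriangle hp
  have := (𝔐.convex_cell K).combo_interior_closure_mem_interior (x := 𝔐.center K) (y := y)
    (by rw [(𝔐.isOpen_cell K).interior_eq]; exact 𝔐.center_mem K)
    (frontier_subset_closure (𝔐.mem_edges.1 h hy)) (a := 1 - r) (b := r) (by linarith) hr.le
    (by ring)
  rwa [(𝔐.isOpen_cell K).interior_eq] at this

theorem volume_openTriangle_inter {K : T} {σ σ' : E} (h : σ ∈ 𝔐.edges K) (h' : σ' ∈ 𝔐.edges K)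
    (hne : σ ≠ σ') : volume (openTriangle (𝔐.center K) (𝔐.fst σ) (𝔐.snd σ) ∩
      openTriangle (𝔐.center K) (𝔐.fst σ') (𝔐.snd σ')) = 0 := by
  by_cases hex : ∃ y₀, y₀ ∈ 𝔐.edge σ ∩ 𝔐.edge σ'
  · obtain ⟨y₀, hy₀⟩ := hex
    refine measure_mono_null (t := (line[ℝ, 𝔐.center K, y₀] : AffineSubspace ℝ Plane)) ?_
      (Measure.addHaar_affineSubspace _ _ fun htop => ?_)
    · rintro p ⟨hp, hp'⟩
      obtain ⟨r, y, hr, hr1, hy, rfl⟩ := exists_of_mem_openTriangle hp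
      obtain ⟨r', y', hr', hr1', hy', he⟩ := exists_of_mem_openTriangle hp'
      have := 𝔐.eq_of_ray hr hr' (𝔐.mem_edges.1 h hy) (𝔐.mem_edges.1 h' hy') he
      subst this
      rw [𝔐.edge_inter σ σ' hne hy₀ ⟨hy, hy'⟩]
      rw [← AffineMap.lineMap_apply_module]
      exact AffineMap.lineMap_mem_affineSpan_pair _ _ _
    · have h1 := finrank_vectorSpan_insert_le_set ℝ ({y₀} : Set Plane) (𝔐.center K)
      rw [← direction_affineSpan, htop, AffineSubspace.direction_top, finrank_top] at h1
      simp at h1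
  · have hemp : openTriangle (𝔐.center K) (𝔐.fst σ) (𝔐.snd σ) ∩
        openTriangle (𝔐.center K) (𝔐.fst σ') (𝔐.snd σ') = ∅ := by
      refine eq_empty_of_forall_notMem fun p hp => hex ?_
      obtain ⟨r, y, hr, hr1, hy, rfl⟩ := exists_of_mem_openTriangle hp.1
      obtain ⟨r', y', hr', hr1', hy', he⟩ := exists_of_mem_openTriangle hp.2
      have := 𝔐.eq_of_ray hr hr' (𝔐.mem_edges.1 h hy) (𝔐.mem_edges.1 h' hy') he
      subst this
      exact ⟨y, hy, hy'⟩
    rw [hemp, measure_empty]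

/-- The triangles with vertex `x_K` over the edges of `K` are contained in `K` and do not
overlap. -/
theorem sum_length_mul_distEdge_le (K : T) :
    volume.real refTriangle * ∑ σ ∈ 𝔐.edges K, 𝔐.length σ * 𝔐.distEdge K σ ≤ 𝔐.area K := by
  have h1 : volume (⋃ σ ∈ 𝔐.edges K, openTriangle (𝔐.center K) (𝔐.fst σ) (𝔐.snd σ))
      = ∑ σ ∈ 𝔐.edges K, volume (openTriangle (𝔐.center K) (𝔐.fst σ) (𝔐.snd σ)) :=
    measure_biUnion_finset₀
      (fun σ hσ σ' hσ' hne => 𝔐.volume_openTriangle_inter hσ hσ' hne)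
      fun σ _ => (convex_openTriangle _ _ _).nullMeasurableSet volume
  have h2 : ∑ σ ∈ 𝔐.edges K, volume (openTriangle (𝔐.center K) (𝔐.fst σ) (𝔐.snd σ))
      ≤ volume (𝔐.cell K) := by
    rw [← h1]
    exact measure_mono (iUnion₂_subset fun σ hσ => 𝔐.openTriangle_subset hσ)
  have htop := (𝔐.isBounded_cell K).measure_lt_top (μ := volume).ne
  have h3 := ENNReal.toReal_mono htop h2
  rw [ENNReal.toReal_sum fun σ hσ => ne_top_of_le_ne_top htop
    (measure_mono (𝔐.openTriangle_subset hσ))] at h3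
  refine le_trans ?_ h3
  rw [Finset.mul_sum]
  refine Finset.sum_le_sum fun σ hσ => ?_
  have h4 := volume_real_openTriangle (𝔐.center K) (𝔐.fst σ) (𝔐.snd σ)
  rw [Measure.real] at h4
  rw [h4, mul_comm]
  refine mul_le_mul_of_nonneg_right ((𝔐.length_mul_distEdge_le K σ).trans (le_of_eq ?_))
    measureReal_nonneg
  congr 1
  simp only [sideDet, planeDet, PiLp.sub_apply]
  ring

/-- Only pairs of cells with a common edge contribute to the total variation. -/
theorem jump_le [Fintype T] (w : T → ℝ) :
    jump 𝔐.cell w ≤ ∑ K, ∑ σ ∈ 𝔐.edges K, 𝔐.length σ * |w K - w (𝔐.nb K σ)| := by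
  classical
  refine Finset.sum_le_sum fun K _ => ?_
  rw [← Finset.sum_fiberwise_of_maps_to (t := Finset.univ) (g := fun σ => 𝔐.nb K σ)
    (fun _ _ => Finset.mem_univ _)]
  refine Finset.sum_le_sum fun L _ => ?_
  have hnn : ∀ σ ∈ (𝔐.edges K).filter fun σ => 𝔐.nb K σ = L,
      0 ≤ 𝔐.length σ * |w K - w (𝔐.nb K σ)| :=
    fun σ _ => mul_nonneg (𝔐.length_pos σ).le (abs_nonneg _)
  by_cases hKL : K = L
  · subst hKL
    simpa using Finset.sum_nonneg hnn
  rcases 𝔐.inter_cells K L hKL with hs | ⟨σ, hσ⟩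
  · rw [Metric.diam_subsingleton hs, zero_mul]
    exact Finset.sum_nonneg hnn
  · have hi : 𝔐.IsInterface K L σ := ⟨hKL, hσ⟩
    have hdiam : Metric.diam (segment ℝ (𝔐.fst σ) (𝔐.snd σ)) ≤ 𝔐.length σ := by
      rw [← convexHull_pair, convexHull_diam, Metric.diam_pair, length]
    rw [hσ]
    refine (mul_le_mul_of_nonneg_right hdiam (abs_nonneg _)).trans ?_
    have := Finset.single_le_sum hnn (a := σ) (Finset.mem_filter.2
      ⟨𝔐.mem_edges.2 hi.edge_subset_frontier, hi.nb_eq⟩)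
    rwa [hi.nb_eq] at this

end Fintype

end AdmissibleMesh

/-! ### The discrete Poincaré and Sobolev inequalities -/

namespace AdmissibleMesh

variable {Ω : Set Plane} {T E : Type} [Fintype T] [Fintype E] (𝔐 : AdmissibleMesh Ω T E)

/-- The discrete Dirichlet form of the two-point flux scheme, each interior edge being counted
twice. -/
noncomputable def dirichlet (f : T → ℝ) : ℝ :=
  ∑ K, ∑ σ ∈ 𝔐.edges K, 𝔐.trans K σ * (f K - f (𝔐.nb K σ)) ^ 2

theorem dirichlet_nonneg (f : T → ℝ) : 0 ≤ 𝔐.dirichlet f :=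
  Finset.sum_nonneg fun K _ => Finset.sum_nonneg fun σ _ =>
    mul_nonneg (𝔐.trans_nonneg K σ) (sq_nonneg _)

theorem sum_length_mul_dEdge_mul_sq_le {ζ : ℝ} (hζ : 0 < ζ) (hreg : 𝔐.IsRegular ζ) (g : T → ℝ) :
    ∑ K, ∑ σ ∈ 𝔐.edges K, 𝔐.length σ * 𝔐.dEdge K σ * (|g K| + |g (𝔐.nb K σ)|) ^ 2
      ≤ 4 / (volume.real refTriangle * ζ) * ∑ K, 𝔐.area K * g K ^ 2 := by
  have hκ := refTriangle_volume_pos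
  have h1 : ∑ K, ∑ σ ∈ 𝔐.edges K, 𝔐.length σ * 𝔐.dEdge K σ * (|g K| + |g (𝔐.nb K σ)|) ^ 2
      ≤ ∑ K, ∑ σ ∈ 𝔐.edges K, (2 * (𝔐.length σ * 𝔐.dEdge K σ * g K ^ 2)
        + 2 * (𝔐.length σ * 𝔐.dEdge (𝔐.nb K σ) σ * g (𝔐.nb K σ) ^ 2)) := by
    refine Finset.sum_le_sum fun K _ => Finset.sum_le_sum fun σ _ => ?_
    rw [dEdge_nb]
    have h2 : (|g K| + |g (𝔐.nb K σ)|) ^ 2 ≤ 2 * g K ^ 2 + 2 * g (𝔐.nb K σ) ^ 2 := by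
      rw [← sq_abs (g K), ← sq_abs (g (𝔐.nb K σ))]
      linarith [sq_nonneg (|g K| - |g (𝔐.nb K σ)|), show (|g K| + |g (𝔐.nb K σ)|) ^ 2 =
        2 * |g K| ^ 2 + 2 * |g (𝔐.nb K σ)| ^ 2 - (|g K| - |g (𝔐.nb K σ)|) ^ 2 by ring]
    have h3 := mul_le_mul_of_nonneg_left h2
      (mul_nonneg (𝔐.length_pos σ).le (𝔐.dEdge_nonneg K σ))
    linarith
  refine h1.trans ?_
  simp only [Finset.sum_add_distrib, ← Finset.mul_sum]
  rw [𝔐.sum_edges_nb fun K σ => 𝔐.length σ * 𝔐.dEdge K σ * g K ^ 2]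
  have h4 : ∀ K, ∑ σ ∈ 𝔐.edges K, 𝔐.length σ * 𝔐.dEdge K σ * g K ^ 2
      ≤ 1 / (volume.real refTriangle * ζ) * (𝔐.area K * g K ^ 2) := by
    intro K
    rw [← Finset.sum_mul, ← mul_assoc]
    refine mul_le_mul_of_nonneg_right ?_ (sq_nonneg _)
    rw [div_mul_eq_mul_div, one_mul, le_div_iff₀ (by positivity)]
    refine le_trans (le_of_eq_of_le ?_ (mul_le_mul_of_nonneg_left
      (Finset.sum_le_sum fun σ hσ => mul_le_mul_of_nonneg_left (hreg K σ hσ) (𝔐.length_pos σ).le)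
        hκ.le)) (𝔐.sum_length_mul_distEdge_le K)
    rw [mul_comm, mul_assoc, Finset.mul_sum]
    congr 1
    exact Finset.sum_congr rfl fun σ _ => by ring
  have h5 := Finset.sum_le_sum fun K (_ : K ∈ Finset.univ) => h4 K
  rw [← Finset.mul_sum] at h5
  calc _ ≤ 4 * (1 / (volume.real refTriangle * ζ) * ∑ K, 𝔐.area K * g K ^ 2) := by linarith
    _ = _ := by ring

/-- The total variation of the signed square of `g`. -/
theorem jump_mul_abs_sq_le {ζ : ℝ} (hζ : 0 < ζ) (hreg : 𝔐.IsRegular ζ) (g : T → ℝ) :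
    jump 𝔐.cell (fun K => g K * |g K|) ^ 2 ≤
      𝔐.dirichlet g * (4 / (volume.real refTriangle * ζ) * ∑ K, 𝔐.area K * g K ^ 2) := by
  have hw : ∀ x y : ℝ, |x * |x| - y * (|y|)| ≤ |x - y| * (|x| + |y|) := by
    intro x y
    have h1 : x * |x| - y * |y| = ((x - y) * (|x| + |y|) + (x + y) * (|x| - |y|)) / 2 := by ring
    have h2 := abs_add_le ((x - y) * (|x| + |y|)) ((x + y) * (|x| - |y|))
    rw [abs_mul, abs_mul, abs_of_nonneg (by positivity : 0 ≤ |x| + |y|)] at h2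
    have h3 : |x + y| * |(|x| - |y|)| ≤ (|x| + |y|) * |x - y| :=
      mul_le_mul (abs_add_le x y) (abs_abs_sub_abs_le x y) (abs_nonneg _) (by positivity)
    rw [h1, abs_div, abs_two]
    linarith
  have h1 : jump 𝔐.cell (fun K => g K * |g K|) ≤ ∑ K, ∑ σ ∈ 𝔐.edges K,
      𝔐.length σ * (|g K - g (𝔐.nb K σ)| * (|g K| + |g (𝔐.nb K σ)|)) :=
    (𝔐.jump_le _).trans (Finset.sum_le_sum fun K _ => Finset.sum_le_sum fun σ _ =>
      mul_le_mul_of_nonneg_left (hw _ _) (𝔐.length_pos σ).le)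
  refine (pow_le_pow_left₀ (jump_nonneg _ _) h1 2).trans ?_
  refine le_trans ?_ (mul_le_mul_of_nonneg_left (𝔐.sum_length_mul_dEdge_mul_sq_le hζ hreg g)
    (𝔐.dirichlet_nonneg g))
  rw [dirichlet, Finset.sum_sigma', Finset.sum_sigma', Finset.sum_sigma']
  refine Finset.sum_sq_le_sum_mul_sum_of_sq_le_mul _ ?_ ?_ ?_
  · rintro ⟨K, σ⟩ -
    exact mul_nonneg (𝔐.trans_nonneg K σ) (sq_nonneg _)
  · rintro ⟨K, σ⟩ -
    exact mul_nonneg (mul_nonneg (𝔐.length_pos σ).le (𝔐.dEdge_nonneg K σ)) (sq_nonneg _)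
  · rintro ⟨K, σ⟩ h
    have hd := 𝔐.dEdge_pos (Finset.mem_sigma.1 h).2
    simp only [trans]
    refine le_of_eq ?_
    rw [mul_pow, mul_pow, sq_abs]
    field_simp

end AdmissibleMesh

/-- The generalized median `c` of `f` for which the signed squares of `f - c` have mean zero. -/
theorem exists_sum_mul_abs_eq_zero {T : Type} [Fintype T] [Nonempty T] {m f : T → ℝ}
    (hm : ∀ K, 0 < m K) (hf : ∀ K, 0 < f K) :
    ∃ c, 0 < c ∧ ∑ K, m K * ((f K - c) * |f K - c|) = 0 := by
  obtain ⟨K₀, hK₀⟩ := Finite.exists_min f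
  obtain ⟨K₁, hK₁⟩ := Finite.exists_max f
  have hcont : Continuous fun c : ℝ => ∑ K, m K * ((f K - c) * |f K - c|) := by fun_prop
  have h0 : 0 ≤ ∑ K, m K * ((f K - f K₀) * |f K - f K₀|) := Finset.sum_nonneg fun K _ =>
    mul_nonneg (hm K).le (mul_nonneg (sub_nonneg.2 (hK₀ K)) (abs_nonneg _))
  have h1 : ∑ K, m K * ((f K - f K₁) * |f K - f K₁|) ≤ 0 := Finset.sum_nonpos fun K _ =>
    mul_nonpos_of_nonneg_of_nonpos (hm K).le
      (mul_nonpos_of_nonpos_of_nonneg (sub_nonpos.2 (hK₁ K)) (abs_nonneg _))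
  obtain ⟨c, hc, hc0⟩ := intermediate_value_Icc' (hK₁ K₀) hcont.continuousOn ⟨h1, h0⟩
  exact ⟨c, (hf K₀).trans_le hc.1, hc0⟩

/-- The discrete Poincaré and Sobolev inequalities. The BV inequality is applied to the signed
square of `f - c`; the choice of `c` makes its variance equal to the fourth moment of `f - c`. -/
theorem IsPolygonalDomain.exists_discrete_sobolev {Ω : Set Plane} (hΩ : IsPolygonalDomain Ω) :
    ∃ C : ℝ, 0 < C ∧ ∀ (T E : Type) [Fintype T] [Fintype E] (𝔐 : AdmissibleMesh Ω T E) (ζ : ℝ),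
      0 < ζ → 𝔐.IsRegular ζ → ∀ f : T → ℝ, (∀ K, 0 < f K) → ∃ c, 0 < c ∧
        ∑ K, 𝔐.area K * (f K - c) ^ 2 ≤ C / ζ * 𝔐.dirichlet f ∧
        ∑ K, 𝔐.area K * (f K - c) ^ 4 ≤ (C / ζ * 𝔐.dirichlet f) ^ 2 := by
  obtain ⟨C₁, hC₁, hlink⟩ := hΩ.linked_self
  have hA : 0 < volume.real Ω := volume_real_pos_of_isOpen hΩ.isOpen hΩ.connected.nonempty
    hΩ.isBounded.measure_lt_top.ne
  set A := volume.real Ω with hAdef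
  have hκ := refTriangle_volume_pos
  set κ := volume.real refTriangle
  set C₀ := 2 * C₁ / κ with hC₀
  have hC₀0 : 0 ≤ C₀ := by positivity
  refine ⟨C₀ + C₀ / Real.sqrt A + 1, by positivity, fun T E _ _ 𝔐 ζ hζ hreg f hf => ?_⟩
  have := 𝔐.nonempty_cells hΩ.connected.nonempty
  obtain ⟨c, hc, hc0⟩ := exists_sum_mul_abs_eq_zero 𝔐.area_pos hf
  refine ⟨c, hc, ?_⟩
  set g : T → ℝ := fun K => f K - c with hg
  set S₂ := ∑ K, 𝔐.area K * g K ^ 2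
  set S₄ := ∑ K, 𝔐.area K * g K ^ 4
  have hS₂0 : 0 ≤ S₂ := Finset.sum_nonneg fun K _ => mul_nonneg (𝔐.area_pos K).le (sq_nonneg _)
  have hS₄0 : 0 ≤ S₄ := Finset.sum_nonneg fun K _ =>
    mul_nonneg (𝔐.area_pos K).le (by positivity)
  have hD : 𝔐.dirichlet g = 𝔐.dirichlet f := by
    simp only [AdmissibleMesh.dirichlet, hg, sub_sub_sub_cancel_right]
  have hvar : crossVariance 𝔐.cell (fun K => g K * |g K|) Ω Ω = 2 * A * S₄ := by
    have harea : ∀ K, volume.real (𝔐.cell K ∩ Ω) = 𝔐.area K := fun K => by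
      rw [inter_eq_left.2 (𝔐.cell_subset K)]; rfl
    have hsq : ∀ K, (g K * |g K|) ^ 2 = g K ^ 4 := fun K => by
      rw [mul_pow, sq_abs]; ring
    have e : ∀ K L, 𝔐.area K * 𝔐.area L * (g K * |g K| - g L * |g L|) ^ 2
        = 𝔐.area K * g K ^ 4 * 𝔐.area L + 𝔐.area K * (𝔐.area L * g L ^ 4)
          - 2 * ((𝔐.area K * (g K * |g K|)) * (𝔐.area L * (g L * |g L|))) := fun K L => by
      rw [← hsq K, ← hsq L]; ring
    simp only [crossVariance, harea, e, Finset.sum_sub_distrib, Finset.sum_add_distrib,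
      ← Finset.mul_sum, ← Finset.sum_mul]
    have hc0' : ∑ K, 𝔐.area K * (g K * |g K|) = 0 := hc0
    rw [hc0', 𝔐.sum_area]
    ring
  have h1 := hlink T 𝔐.cell 𝔐.isCellPartition fun K => g K * |g K|
  have h2 := mul_le_mul_of_nonneg_left (𝔐.jump_mul_abs_sq_le hζ hreg g) hC₁
  rw [hvar] at h1
  rw [hD] at h2
  set D := 𝔐.dirichlet f
  have hD0 : 0 ≤ D := 𝔐.dirichlet_nonneg f
  have h3 : A * S₄ ≤ C₀ / ζ * D * S₂ := by
    have e : C₁ * (D * (4 / (κ * ζ) * S₂)) = 2 * (C₀ / ζ * D * S₂) := by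
      rw [hC₀]; field_simp; ring
    rw [e] at h2
    linarith
  have h4 : S₂ ^ 2 ≤ A * S₄ := by
    rw [hAdef, ← 𝔐.sum_area]
    refine Finset.sum_sq_le_sum_mul_sum_of_sq_le_mul _ (fun K _ => (𝔐.area_pos K).le)
      (fun K _ => mul_nonneg (𝔐.area_pos K).le (by positivity)) fun K _ => le_of_eq (by ring)
  set B := C₀ / ζ * D with hB
  have hB0 : 0 ≤ B := by positivity
  have h5 : S₂ ≤ B := by
    by_contra hlt
    push Not at hlt
    nlinarith
  have hle : B ≤ (C₀ + C₀ / Real.sqrt A + 1) / ζ * D := by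
    rw [hB]
    have : 0 ≤ C₀ / Real.sqrt A := by positivity
    gcongr
    linarith
  refine ⟨h5.trans hle, ?_⟩
  have h6 : A * S₄ ≤ B ^ 2 := by nlinarith
  have h7 : S₄ ≤ (B / Real.sqrt A) ^ 2 := by
    rw [div_pow, Real.sq_sqrt hA.le, le_div_iff₀ hA]
    linarith
  refine h7.trans (pow_le_pow_left₀ (by positivity) ?_ 2)
  have e : B / Real.sqrt A = (C₀ / Real.sqrt A) / ζ * D := by rw [hB]; ring
  rw [e]
  gcongr
  linarith

/-! ### Entropy inequalities and the dissipation of the scheme -/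

/-- The Beckner inequality, up to the Poincaré inequality for `v ^ (p / 2)`. The entropy is the
infimum over `t > 0` of the sums of the remainders of the tangents to `v ↦ v ^ p` at `t`. -/
theorem sum_Phi_le_sum_sq {T : Type} [Fintype T] {μ v : T → ℝ} (hμ : ∀ K, 0 < μ K)
    (hv : ∀ K, 0 < v K) (hmass : ∑ K, μ K * v K = ∑ K, μ K) {p : ℝ} (hp : 1 < p) (hp2 : p ≤ 2)
    {c : ℝ} (hc : 0 < c) :
    (p - 1) * ∑ K, μ K * Phi p (v K) ≤ ∑ K, μ K * (v K ^ (p / 2) - c) ^ 2 := by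
  have hp0 : 0 < p - 1 := sub_pos.2 hp
  set t := c ^ (2 / p) with ht
  have ht0 : 0 < t := by positivity
  have htp : t ^ p = c ^ 2 := by
    rw [ht, ← Real.rpow_mul hc.le, div_mul_cancel₀ _ (by linarith : p ≠ 0)]
    norm_num
  have h1 : ∑ K, μ K * (v K ^ p - c ^ 2 - p * t ^ (p - 1) * (v K - t))
      ≤ ∑ K, μ K * (v K ^ (p / 2) - c) ^ 2 :=
    Finset.sum_le_sum fun K _ => mul_le_mul_of_nonneg_left
      (rpow_sub_tangent_le_sq hp hp2 (hv K) hc) (hμ K).le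
  have e1 : ∑ K, μ K * (v K ^ p - c ^ 2 - p * t ^ (p - 1) * (v K - t))
      = ∑ K, μ K * v K ^ p - (∑ K, μ K) * (c ^ 2 + p * t ^ (p - 1) * (1 - t)) := by
    have : ∀ K, μ K * (v K ^ p - c ^ 2 - p * t ^ (p - 1) * (v K - t)) = μ K * v K ^ p
        - μ K * (c ^ 2 - p * t ^ (p - 1) * t) - μ K * v K * (p * t ^ (p - 1)) :=
      fun K => by ring
    simp only [this, Finset.sum_sub_distrib, ← Finset.sum_mul]
    rw [hmass]; ring
  have e2 : (p - 1) * ∑ K, μ K * Phi p (v K) = ∑ K, μ K * v K ^ p - ∑ K, μ K := by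
    have : ∀ K, (p - 1) * (μ K * Phi p (v K)) = μ K * v K ^ p - μ K * v K * p + μ K * (p - 1) :=
      fun K => by rw [Phi, if_neg hp.ne']; field_simp
    rw [Finset.mul_sum]
    simp only [this, Finset.sum_add_distrib, Finset.sum_sub_distrib, ← Finset.sum_mul]
    rw [hmass]; ring
  have h2 := rpow_tangent_le hp.le zero_le_one ht0 (p := p) (a := 1)
  rw [htp, Real.one_rpow] at h2
  have h3 := mul_le_mul_of_nonneg_left h2
    (Finset.sum_nonneg fun K _ => (hμ K).le : 0 ≤ ∑ K, μ K)
  rw [e2]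
  rw [e1] at h1
  linarith

/-- The logarithmic Sobolev inequality, up to the Sobolev inequality for `√v` in `L⁴`. -/
theorem sum_Phi_one_le {T : Type} [Fintype T] {μ v : T → ℝ} (hμ : ∀ K, 0 < μ K)
    (hv : ∀ K, 0 < v K) (hmass : ∑ K, μ K * v K = ∑ K, μ K) {c s : ℝ} (hs : 0 < s)
    (h4 : ∑ K, μ K * (v K ^ (1 / 2 : ℝ) - c) ^ 4 ≤ (∑ K, μ K) * s ^ 2) :
    ∑ K, μ K * Phi 1 (v K) ≤ 18 * (∑ K, μ K) * s := by
  set N := ∑ K, μ K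
  have hN0 : 0 ≤ N := Finset.sum_nonneg fun K _ => (hμ K).le
  set g : T → ℝ := fun K => v K ^ (1 / 2 : ℝ) - c
  have h2 : ∑ K, μ K * g K ^ 2 ≤ N * s := by
    have hcs : (∑ K, μ K * g K ^ 2) ^ 2 ≤ N * ∑ K, μ K * g K ^ 4 :=
      Finset.sum_sq_le_sum_mul_sum_of_sq_le_mul _ (fun K _ => (hμ K).le)
        (fun K _ => mul_nonneg (hμ K).le (by positivity)) fun K _ => le_of_eq (by ring)
    refine le_of_sq_le_sq (hcs.trans ?_) (by positivity)
    calc N * ∑ K, μ K * g K ^ 4 ≤ N * (N * s ^ 2) := mul_le_mul_of_nonneg_left h4 hN0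
      _ = (N * s) ^ 2 := by ring
  -- a reference value `t` of `v` that does not degenerate when `c` is small
  set t := c ^ 2 + s
  have ht0 : 0 < t := by positivity
  have h1 : ∑ K, μ K * (v K * Real.log (v K) - v K * Real.log t - v K + t)
      ≤ ∑ K, μ K * (12 * g K ^ 2 + 3 * g K ^ 4 / s + 3 * s) := by
    refine Finset.sum_le_sum fun K _ => mul_le_mul_of_nonneg_left ?_ (hμ K).le
    have hf : 0 < v K ^ (1 / 2 : ℝ) := Real.rpow_pos_of_pos (hv K) _
    have e : v K = (v K ^ (1 / 2 : ℝ)) ^ 2 := by rw [← Real.sqrt_eq_rpow, Real.sq_sqrt (hv K).le]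
    have := mul_log_sub_le_of_sq (c := c) hf hs
    rw [← e] at this
    exact this
  have e1 : ∑ K, μ K * (v K * Real.log (v K) - v K * Real.log t - v K + t)
      = ∑ K, μ K * (v K * Real.log (v K)) - N * Real.log t - N + N * t := by
    have : ∀ K, μ K * (v K * Real.log (v K) - v K * Real.log t - v K + t)
        = μ K * (v K * Real.log (v K)) - μ K * v K * Real.log t - μ K * v K + μ K * t :=
      fun K => by ring
    simp only [this, Finset.sum_add_distrib, Finset.sum_sub_distrib, ← Finset.sum_mul]
    rw [hmass]
  have e2 : ∑ K, μ K * (12 * g K ^ 2 + 3 * g K ^ 4 / s + 3 * s)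
      = 12 * ∑ K, μ K * g K ^ 2 + 3 / s * ∑ K, μ K * g K ^ 4 + N * (3 * s) := by
    have : ∀ K, μ K * (12 * g K ^ 2 + 3 * g K ^ 4 / s + 3 * s)
        = 12 * (μ K * g K ^ 2) + 3 / s * (μ K * g K ^ 4) + μ K * (3 * s) := fun K => by ring
    simp only [this, Finset.sum_add_distrib, ← Finset.mul_sum, ← Finset.sum_mul]
    rfl
  have e3 : ∑ K, μ K * Phi 1 (v K) = ∑ K, μ K * (v K * Real.log (v K)) := by
    have : ∀ K, μ K * Phi 1 (v K) = μ K * (v K * Real.log (v K)) - μ K * v K + μ K :=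
      fun K => by rw [Phi, if_pos rfl]; ring
    simp only [this, Finset.sum_add_distrib, Finset.sum_sub_distrib]
    rw [hmass]; ring
  have h5 : 3 / s * ∑ K, μ K * g K ^ 4 ≤ 3 * N * s := by
    calc 3 / s * ∑ K, μ K * g K ^ 4 ≤ 3 / s * (N * s ^ 2) :=
          mul_le_mul_of_nonneg_left h4 (by positivity)
      _ = 3 * N * s := by field_simp
  have h6 := mul_le_mul_of_nonneg_left (Real.log_le_sub_one_of_pos ht0) hN0
  rw [e3]
  rw [e1, e2] at h1
  linarith

section Scheme

variable {Ω : Set Plane} {T E : Type} {𝔐 : AdmissibleMesh Ω T E}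
  {r : ℝ → ℝ → ℝ} {V u₀ : Plane → ℝ} {Δt M₁ : ℝ} {u : ℕ → T → ℝ}

theorem flux_nb (hr : IsMeanFunction r) {w : T → ℝ} (hw : ∀ K, 0 < w K) (K : T) (σ : E) :
    flux 𝔐 r V w (𝔐.nb K σ) σ = -flux 𝔐 r V w K σ := by
  unfold flux
  rw [𝔐.nb_nb, 𝔐.trans_nb, hr.symm _ _ (hw (𝔐.nb K σ)) (hw K)]
  ring

theorem IsMeanFunction.mul_sub_le (hr : IsMeanFunction r) {m x y a b : ℝ} (hm : 0 < m) (hx : 0 < x)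
    (hy : 0 < y) (ha : m ≤ a) (hb : m ≤ b) {φ : ℝ → ℝ}
    (hφ : ∀ x y, 0 < x → x ≤ y → φ x ≤ φ y) :
    m * ((x - y) * (φ x - φ y)) ≤
      r (a * x) (b * y) * ((Real.log x - Real.log y) * (φ x - φ y)) := by
  rcases eq_or_ne x y with rfl | hxy
  · simp
  have h1 : m * r x y ≤ r (a * x) (b * y) := by
    rw [← hr.homog m x y hm hx hy]
    exact hr.mono _ _ _ _ (by positivity) (by positivity) (by gcongr) (by gcongr)
  have h2 := hr.lower x y hx hy hxy
  have hne : Real.log x - Real.log y ≠ 0 := fun h =>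
    hxy (Real.log_injOn_pos hx hy (sub_eq_zero.1 h))
  have h3 : 0 ≤ (Real.log x - Real.log y) * (φ x - φ y) := by
    rcases le_total x y with h | h
    · exact mul_nonneg_of_nonpos_of_nonpos (sub_nonpos.2 (Real.log_le_log hx h))
        (sub_nonpos.2 (hφ x y hx h))
    · exact mul_nonneg (sub_nonneg.2 (Real.log_le_log hy h)) (sub_nonneg.2 (hφ y x hy h))
  calc m * ((x - y) * (φ x - φ y))
      = m * ((x - y) / (Real.log x - Real.log y)) *
          ((Real.log x - Real.log y) * (φ x - φ y)) := by field_simp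
    _ ≤ r (a * x) (b * y) * ((Real.log x - Real.log y) * (φ x - φ y)) :=
        mul_le_mul_of_nonneg_right ((mul_le_mul_of_nonneg_left h2 hm.le).trans h1) h3

section SteadyState

variable [Fintype T] [Nonempty T]

theorem sum_area_mul_exp_pos (𝔐 : AdmissibleMesh Ω T E) (V : Plane → ℝ) :
    0 < ∑ L, 𝔐.area L * Real.exp (-V (𝔐.center L)) :=
  Finset.sum_pos (fun L _ => mul_pos (𝔐.area_pos L) (Real.exp_pos _)) Finset.univ_nonempty

theorem steadyState_pos (hM : 0 < M₁) (K : T) : 0 < steadyState 𝔐 V M₁ K :=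
  mul_pos (div_pos hM (sum_area_mul_exp_pos 𝔐 V)) (Real.exp_pos _)

theorem sum_area_mul_steadyState :
    ∑ K, 𝔐.area K * steadyState 𝔐 V M₁ K = M₁ := by
  have h := sum_area_mul_exp_pos 𝔐 V
  have e : ∀ K, 𝔐.area K * steadyState 𝔐 V M₁ K = M₁ / (∑ L, 𝔐.area L *
      Real.exp (-V (𝔐.center L))) * (𝔐.area K * Real.exp (-V (𝔐.center K))) := fun K => by
    rw [steadyState]; ring
  simp only [e, ← Finset.mul_sum]
  exact div_mul_cancel₀ _ h.ne'

theorem log_add_eq (hM : 0 < M₁) {w : ℝ} (hw : 0 < w) (K : T) :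
    Real.log w + V (𝔐.center K) = Real.log (w / steadyState 𝔐 V M₁ K)
      + Real.log (M₁ / ∑ L, 𝔐.area L * Real.exp (-V (𝔐.center L))) := by
  have h := sum_area_mul_exp_pos 𝔐 V
  rw [Real.log_div hw.ne' (steadyState_pos hM K).ne', steadyState,
    Real.log_mul (div_pos hM h).ne' (Real.exp_pos _).ne', Real.log_exp]
  ring

end SteadyState

variable [Fintype E]

namespace IsSolution

theorem init_nonneg (hu : IsSolution 𝔐 r V u₀ Δt u) (h₀ : IsInitialDatum Ω u₀) (K : T) :
    0 ≤ u 0 K := by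
  rw [hu.init K]
  refine mul_nonneg (div_nonneg zero_le_one (𝔐.area_pos K).le) ?_
  exact integral_nonneg_of_ae (ae_restrict_of_ae_restrict_of_subset (𝔐.cell_subset K) h₀.nonneg)

theorem nonneg (hu : IsSolution 𝔐 r V u₀ Δt u) (h₀ : IsInitialDatum Ω u₀) (n : ℕ) (K : T) :
    0 ≤ u n K := by
  cases n with
  | zero => exact hu.init_nonneg h₀ K
  | succ n => exact (hu.pos n K).le

theorem area_mul_sub (hu : IsSolution 𝔐 r V u₀ Δt u) (hΔ : 0 < Δt) (n : ℕ) (K : T) :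
    𝔐.area K * (u (n + 1) K - u n K)
      = -(Δt * ∑ σ ∈ 𝔐.edges K, flux 𝔐 r V (u (n + 1)) K σ) := by
  have h := hu.scheme n K
  have e : 𝔐.area K * (u (n + 1) K - u n K)
      = Δt * (𝔐.area K * ((u (n + 1) K - u n K) / Δt)) := by field_simp
  rw [e, eq_neg_of_add_eq_zero_left h]
  ring

end IsSolution

variable [Fintype T]

/-- Discrete integration by parts. -/
theorem sum_flux_mul (hr : IsMeanFunction r) {w : T → ℝ} (hw : ∀ K, 0 < w K) (ψ : T → ℝ) :
    ∑ K, (∑ σ ∈ 𝔐.edges K, flux 𝔐 r V w K σ) * ψ K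
      = 1 / 2 * ∑ K, ∑ σ ∈ 𝔐.edges K, flux 𝔐 r V w K σ * (ψ K - ψ (𝔐.nb K σ)) := by
  have h := 𝔐.sum_edges_nb fun K σ => flux 𝔐 r V w K σ * ψ K
  simp only [flux_nb hr hw, neg_mul, Finset.sum_neg_distrib] at h
  simp only [mul_sub, Finset.sum_sub_distrib, Finset.sum_mul]
  linarith

/-- The entropy dissipation dominates the Dirichlet form of `(w / u^∞) ^ (p / 2)`. -/
theorem mul_dirichlet_le_sum_flux [Nonempty T] (hr : IsMeanFunction r) (hM : 0 < M₁) {w : T → ℝ}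
    (hw : ∀ K, 0 < w K) {m : ℝ} (hm : 0 < m) (hm' : ∀ K, m ≤ steadyState 𝔐 V M₁ K) {p : ℝ}
    (hp : 1 ≤ p) (hp2 : p ≤ 2) :
    m * 𝔐.dirichlet (fun K => (w K / steadyState 𝔐 V M₁ K) ^ (p / 2)) ≤
      ∑ K, (∑ σ ∈ 𝔐.edges K, flux 𝔐 r V w K σ) * dPhi p (w K / steadyState 𝔐 V M₁ K) := by
  rw [sum_flux_mul hr hw, AdmissibleMesh.dirichlet, Finset.mul_sum, Finset.mul_sum]
  refine Finset.sum_le_sum fun K _ => ?_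
  rw [Finset.mul_sum, Finset.mul_sum]
  refine Finset.sum_le_sum fun σ _ => ?_
  set L := 𝔐.nb K σ with hL
  have hs := fun K => steadyState_pos (𝔐 := 𝔐) (V := V) hM K
  have hx : 0 < w K / steadyState 𝔐 V M₁ K := div_pos (hw K) (hs K)
  have hy : 0 < w L / steadyState 𝔐 V M₁ L := div_pos (hw L) (hs L)
  have h1 := hr.mul_sub_le hm hx hy (hm' K) (hm' L) (φ := dPhi p)
    fun x y hx hxy => dPhi_mono hp hx hxy
  rw [mul_div_cancel₀ _ (hs K).ne', mul_div_cancel₀ _ (hs L).ne'] at h1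
  have h2 := mul_le_mul_of_nonneg_left (two_mul_sq_le_mul_dPhi hp hp2 hx hy) hm.le
  have h3 := mul_le_mul_of_nonneg_left (h2.trans h1) (𝔐.trans_nonneg K σ)
  simp only [flux, ← hL]
  rw [log_add_eq hM (hw K) K, log_add_eq hM (hw L) L]
  linarith

namespace IsSolution

theorem mass_init (hu : IsSolution 𝔐 r V u₀ Δt u) (h₀ : IsInitialDatum Ω u₀)
    (hΩ : volume Ω ≠ ⊤) : ∑ K, 𝔐.area K * u 0 K = ∫ x in Ω, u₀ x := by
  have : IsFiniteMeasure (volume.restrict Ω) := ⟨by simpa using hΩ.lt_top⟩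
  have hint : IntegrableOn u₀ Ω := h₀.memLp.integrable (by norm_num)
  have hae : (⋃ K, 𝔐.cell K) =ᵐ[volume] Ω :=
    Filter.EventuallyLE.antisymm (iUnion_subset 𝔐.cell_subset).eventuallyLE
      (ae_le_set.2 𝔐.isCellPartition.volume_diff)
  rw [← setIntegral_congr_set hae, integral_iUnion_fintype
    (fun K => (𝔐.isOpen_cell K).measurableSet) (fun K L h => 𝔐.cell_disjoint K L h)
    fun K => hint.mono_set (𝔐.cell_subset K)]
  refine Finset.sum_congr rfl fun K _ => ?_
  have := (𝔐.area_pos K).ne'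
  rw [hu.init K]
  field_simp

theorem mass (hu : IsSolution 𝔐 r V u₀ Δt u) (hr : IsMeanFunction r) (h₀ : IsInitialDatum Ω u₀)
    (hΩ : volume Ω ≠ ⊤) (hΔ : 0 < Δt) (n : ℕ) : ∑ K, 𝔐.area K * u n K = ∫ x in Ω, u₀ x := by
  induction n with
  | zero => exact hu.mass_init h₀ hΩ
  | succ n ih =>
    have h := sum_flux_mul (𝔐 := 𝔐) (V := V) hr (hu.pos n) fun _ => 1
    simp only [mul_one, sub_self, mul_zero, Finset.sum_const_zero] at h
    have h2 : ∑ K, 𝔐.area K * (u (n + 1) K - u n K) = 0 := by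
      simp only [hu.area_mul_sub hΔ, Finset.sum_neg_distrib, ← Finset.mul_sum, h, mul_zero,
        neg_zero]
    simp only [mul_sub, Finset.sum_sub_distrib] at h2
    linarith

/-- The discrete entropy dissipation inequality. -/
theorem relEntropy_succ_add_le [Nonempty T] (hu : IsSolution 𝔐 r V u₀ Δt u) (hr : IsMeanFunction r)
    (h₀ : IsInitialDatum Ω u₀) (hΔ : 0 < Δt) (hM : 0 < M₁) {m : ℝ} (hm : 0 < m)
    (hm' : ∀ K, m ≤ steadyState 𝔐 V M₁ K) {p : ℝ} (hp : 1 ≤ p) (hp2 : p ≤ 2) (n : ℕ) :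
    relEntropy 𝔐 V M₁ p (u (n + 1)) +
      Δt * (m * 𝔐.dirichlet fun K => (u (n + 1) K / steadyState 𝔐 V M₁ K) ^ (p / 2))
      ≤ relEntropy 𝔐 V M₁ p (u n) := by
  have hs := fun K => steadyState_pos (𝔐 := 𝔐) (V := V) hM K
  have h1 : relEntropy 𝔐 V M₁ p (u (n + 1)) + ∑ K, 𝔐.area K * (u n K - u (n + 1) K) *
      dPhi p (u (n + 1) K / steadyState 𝔐 V M₁ K) ≤ relEntropy 𝔐 V M₁ p (u n) := by
    unfold relEntropy
    rw [← Finset.sum_add_distrib]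
    refine Finset.sum_le_sum fun K _ => ?_
    have h := mul_le_mul_of_nonneg_left (Phi_tangent_le hp
      (div_nonneg (hu.nonneg h₀ n K) (hs K).le) (div_pos (hu.pos n K) (hs K)))
      (mul_nonneg (𝔐.area_pos K).le (hs K).le)
    refine le_trans (le_of_eq ?_) h
    have := (hs K).ne'
    field_simp
  have h2 : ∑ K, 𝔐.area K * (u n K - u (n + 1) K) * dPhi p (u (n + 1) K / steadyState 𝔐 V M₁ K)
      = Δt * ∑ K, (∑ σ ∈ 𝔐.edges K, flux 𝔐 r V (u (n + 1)) K σ) *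
        dPhi p (u (n + 1) K / steadyState 𝔐 V M₁ K) := by
    rw [Finset.mul_sum]
    refine Finset.sum_congr rfl fun K _ => ?_
    have e : 𝔐.area K * (u n K - u (n + 1) K) = -(𝔐.area K * (u (n + 1) K - u n K)) := by ring
    rw [e, hu.area_mul_sub hΔ]
    ring
  have h3 := mul_le_mul_of_nonneg_left
    (mul_dirichlet_le_sum_flux (𝔐 := 𝔐) (V := V) hr hM (hu.pos n) hm hm' hp hp2) hΔ.le
  linarith

end IsSolution

end Scheme

/-! ### Exponential decay of the entropy -/

/-- The entropy - entropy dissipation inequality. For `p = 1` it is a logarithmic Sobolev inequality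
and for `p > 1` a Beckner inequality. -/
theorem IsPolygonalDomain.exists_explicitRate_mul_le {Ω : Set Plane} (hΩ : IsPolygonalDomain Ω) :
    ∃ C : ℝ, 0 < C ∧ ∀ (T E : Type) [Fintype T] [Fintype E] (𝔐 : AdmissibleMesh Ω T E) (ζ : ℝ),
      0 < ζ → 𝔐.IsRegular ζ → ∀ (V : Plane → ℝ) (M₁ m M p : ℝ), 0 < M₁ → 0 < m →
      (∀ K, m ≤ steadyState 𝔐 V M₁ K ∧ steadyState 𝔐 V M₁ K ≤ M) → 1 ≤ p → p ≤ 2 →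
      ∀ w : T → ℝ, (∀ K, 0 < w K) → ∑ K, 𝔐.area K * w K = M₁ →
        explicitRate C C ζ m M M₁ p * relEntropy 𝔐 V M₁ p w ≤
          m * 𝔐.dirichlet fun K => (w K / steadyState 𝔐 V M₁ K) ^ (p / 2) := by
  obtain ⟨C, hC, hsob⟩ := hΩ.exists_discrete_sobolev
  refine ⟨18 * C, by positivity, ?_⟩
  intro T E _ _ 𝔐 ζ hζ hreg V M₁ m M p hM₁ hm hmM hp hp2 w hw hmass
  have : Nonempty T := 𝔐.nonempty_cells hΩ.connected.nonempty
  have K₀ := Classical.arbitrary T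
  have hζ1 : ζ ≤ 1 := AdmissibleMesh.IsRegular.le_one 𝔐 hreg K₀
  have hs := fun K => steadyState_pos (𝔐 := 𝔐) (V := V) hM₁ K
  have hM : 0 < M := hm.trans_le ((hmM K₀).1.trans (hmM K₀).2)
  set v : T → ℝ := fun K => w K / steadyState 𝔐 V M₁ K with hv
  have hv0 : ∀ K, 0 < v K := fun K => div_pos (hw K) (hs K)
  set μ : T → ℝ := fun K => 𝔐.area K * steadyState 𝔐 V M₁ K with hμ
  have hμ0 : ∀ K, 0 < μ K := fun K => mul_pos (𝔐.area_pos K) (hs K)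
  have hμM : ∑ K, μ K = M₁ := sum_area_mul_steadyState
  have hμv : ∑ K, μ K * v K = ∑ K, μ K := by
    rw [hμM, ← hmass]
    refine Finset.sum_congr rfl fun K _ => ?_
    have := (hs K).ne'
    simp only [hμ, hv]; field_simp
  have hμle : ∀ g : T → ℝ, (∀ K, 0 ≤ g K) → ∑ K, μ K * g K ≤ M * ∑ K, 𝔐.area K * g K := by
    intro g hg
    rw [Finset.mul_sum]
    refine Finset.sum_le_sum fun K _ => ?_
    have h1 := mul_le_mul_of_nonneg_right (hmM K).2 (mul_nonneg (𝔐.area_pos K).le (hg K))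
    calc μ K * g K = steadyState 𝔐 V M₁ K * (𝔐.area K * g K) := by simp only [hμ]; ring
      _ ≤ _ := h1
  obtain ⟨c, hc, h2, h4⟩ := hsob T E 𝔐 ζ hζ hreg (fun K => v K ^ (p / 2))
    fun K => Real.rpow_pos_of_pos (hv0 K) _
  set D := 𝔐.dirichlet fun K => v K ^ (p / 2)
  have hD0 : 0 ≤ D := 𝔐.dirichlet_nonneg _
  show explicitRate (18 * C) (18 * C) ζ m M M₁ p * ∑ K, μ K * Phi p (v K) ≤ m * D
  rcases hp.eq_or_lt with rfl | hp
  · have hQ0 : 0 ≤ C / ζ * D := by positivity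
    set Q := C / ζ * D with hQ
    have hR : 0 < Real.sqrt (M * M₁) := Real.sqrt_pos.2 (by positivity)
    have hR2 : Real.sqrt (M * M₁) ^ 2 = M * M₁ := Real.sq_sqrt (by positivity)
    set R := Real.sqrt (M * M₁)
    -- the `L⁴` norm may vanish, so it is replaced by a larger number
    have hlt : ∀ Q', Q < Q' → ∑ K, μ K * Phi 1 (v K) ≤ 18 * R * Q' := by
      intro Q' hQ'
      have hQ'0 : 0 < Q' := hQ0.trans_lt hQ'
      have h5 := sum_Phi_one_le hμ0 hv0 hμv (c := c) (s := R / M₁ * Q') (by positivity) (by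
        calc ∑ K, μ K * (v K ^ (1 / 2 : ℝ) - c) ^ 4
            ≤ M * ∑ K, 𝔐.area K * (v K ^ (1 / 2 : ℝ) - c) ^ 4 :=
              hμle _ fun K => by positivity
          _ ≤ M * Q' ^ 2 := mul_le_mul_of_nonneg_left
              (h4.trans (pow_le_pow_left₀ hQ0 hQ'.le 2)) hM.le
          _ = (∑ K, μ K) * (R / M₁ * Q') ^ 2 := by
              rw [hμM, mul_pow, div_pow, hR2]; field_simp)
      rw [hμM] at h5
      refine h5.trans (le_of_eq ?_)
      field_simp
    have hle : ∑ K, μ K * Phi 1 (v K) ≤ 18 * R * Q := by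
      refine le_of_forall_pos_le_add fun ε hε => ?_
      refine (hlt (Q + ε / (18 * R)) (by
        have : 0 < ε / (18 * R) := by positivity
        linarith)).trans (le_of_eq ?_)
      field_simp
    have hrate : 0 ≤ ζ ^ 2 / (18 * C) * (m / R) := by positivity
    rw [explicitRate, if_pos rfl]
    calc ζ ^ 2 / (18 * C) * (m / R) * ∑ K, μ K * Phi 1 (v K)
        ≤ ζ ^ 2 / (18 * C) * (m / R) * (18 * R * Q) := mul_le_mul_of_nonneg_left hle hrate
      _ = ζ * (m * D) := by rw [hQ]; field_simp
      _ ≤ m * D := mul_le_of_le_one_left (by positivity) hζ1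
  · have h5 := (sum_Phi_le_sum_sq hμ0 hv0 hμv hp hp2 hc).trans
      ((hμle _ fun K => sq_nonneg _).trans (mul_le_mul_of_nonneg_left h2 hM.le))
    rw [explicitRate, if_neg hp.ne']
    have hrate : 0 ≤ ζ / (18 * C) * (m / M) := by positivity
    calc (p - 1) * (ζ / (18 * C)) * (m / M) * ∑ K, μ K * Phi p (v K)
        = ζ / (18 * C) * (m / M) * ((p - 1) * ∑ K, μ K * Phi p (v K)) := by ring
      _ ≤ ζ / (18 * C) * (m / M) * (M * (C / ζ * D)) := mul_le_mul_of_nonneg_left h5 hrate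
      _ = m * D / 18 := by field_simp
      _ ≤ m * D := by
        have : 0 ≤ m * D := by positivity
        linarith

theorem explicitRate_pos {C ζ m M M₁ p : ℝ} (hC : 0 < C) (hζ : 0 < ζ) (hm : 0 < m) (hM : 0 < M)
    (hM₁ : 0 < M₁) (hp : 1 ≤ p) : 0 < explicitRate C C ζ m M M₁ p := by
  unfold explicitRate
  split_ifs with h
  · have : 0 < Real.sqrt (M * M₁) := Real.sqrt_pos.2 (by positivity)
    positivity
  · have : 0 < p - 1 := sub_pos.2 (lt_of_le_of_ne hp (Ne.symm h))
    positivity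

theorem IsC1UpToBoundary.exists_abs_le {Ω : Set Plane} (hΩ : Bornology.IsBounded Ω)
    {V : Plane → ℝ} (hV : IsC1UpToBoundary Ω V) : ∃ B, ∀ x ∈ Ω, |V x| ≤ B := by
  have hc : IsCompact (closure Ω) :=
    Metric.isCompact_of_isClosed_isBounded isClosed_closure hΩ.closure
  obtain ⟨B, hB⟩ := hc.exists_bound_of_continuousOn hV.continuousOn
  exact ⟨B, fun x hx => hB x (subset_closure hx)⟩

/-- Bounds for the steady state that depend only on a bound of the potential. -/
theorem steadyState_mem_Icc {Ω : Set Plane} {T E : Type} [Fintype T] [Nonempty T]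
    (𝔐 : AdmissibleMesh Ω T E) {V : Plane → ℝ} {B M₁ : ℝ} (hB : ∀ x ∈ Ω, |V x| ≤ B)
    (hM : 0 < M₁) (hA : 0 < volume.real Ω) (K : T) :
    M₁ * (Real.exp (-(2 * B)) / volume.real Ω) ≤ steadyState 𝔐 V M₁ K ∧
      steadyState 𝔐 V M₁ K ≤ M₁ * (Real.exp (2 * B) / volume.real Ω) := by
  have hbd : ∀ L, Real.exp (-B) ≤ Real.exp (-V (𝔐.center L)) ∧
      Real.exp (-V (𝔐.center L)) ≤ Real.exp B := fun L => by
    have := abs_le.1 (hB _ (𝔐.cell_subset L (𝔐.center_mem L)))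
    exact ⟨Real.exp_le_exp.2 (by linarith), Real.exp_le_exp.2 (by linarith)⟩
  have hZ := sum_area_mul_exp_pos 𝔐 V
  have hZ1 : ∑ L, 𝔐.area L * Real.exp (-V (𝔐.center L)) ≤ volume.real Ω * Real.exp B := by
    rw [← 𝔐.sum_area, Finset.sum_mul]
    exact Finset.sum_le_sum fun L _ => mul_le_mul_of_nonneg_left (hbd L).2 (𝔐.area_pos L).le
  have hZ2 : volume.real Ω * Real.exp (-B) ≤ ∑ L, 𝔐.area L * Real.exp (-V (𝔐.center L)) := by
    rw [← 𝔐.sum_area, Finset.sum_mul]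
    exact Finset.sum_le_sum fun L _ => mul_le_mul_of_nonneg_left (hbd L).1 (𝔐.area_pos L).le
  unfold steadyState
  set Z := ∑ L, 𝔐.area L * Real.exp (-V (𝔐.center L))
  constructor
  · calc M₁ * (Real.exp (-(2 * B)) / volume.real Ω)
        = M₁ / (volume.real Ω * Real.exp B) * Real.exp (-B) := by
          rw [show -(2 * B) = -B + -B by ring, Real.exp_add, Real.exp_neg]; field_simp
      _ ≤ M₁ / Z * Real.exp (-V (𝔐.center K)) :=
          mul_le_mul (div_le_div_of_nonneg_left hM.le hZ hZ1) (hbd K).1 (Real.exp_pos _).le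
            (by positivity)
  · calc M₁ / Z * Real.exp (-V (𝔐.center K))
        ≤ M₁ / (volume.real Ω * Real.exp (-B)) * Real.exp B :=
          mul_le_mul (div_le_div_of_nonneg_left hM.le (by positivity) hZ2) (hbd K).2
            (Real.exp_pos _).le (by positivity)
      _ = M₁ * (Real.exp (2 * B) / volume.real Ω) := by
          rw [show 2 * B = B + B by ring, Real.exp_add, Real.exp_neg]; field_simp

theorem theorem3p1 (Ω : Set Plane) (hΩ : IsPolygonalDomain Ω) :
    ∃ C_LS > (0 : ℝ), ∃ C_B > (0 : ℝ),
      ∀ V : Plane → ℝ, IsC1UpToBoundary Ω V → ∀ ζ : ℝ, 0 < ζ →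
        ∃ ν : ℝ → ℝ → ℝ,
          (∀ p ∈ Set.Icc (1 : ℝ) 2, ∀ M₁ : ℝ, 0 < M₁ → 0 < ν p M₁) ∧
          (∀ p ∈ Set.Ioc (1 : ℝ) 2, ∀ M₁ M₁' : ℝ, ν p M₁ = ν p M₁') ∧
          ∀ (T E : Type) [Fintype T] [Fintype E] (𝔐 : AdmissibleMesh Ω T E), 𝔐.IsRegular ζ →
            ∀ r : ℝ → ℝ → ℝ, IsMeanFunction r →
            ∀ u₀ : Plane → ℝ, IsInitialDatum Ω u₀ →
            ∀ Δt : ℝ, 0 < Δt →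
            ∀ u : ℕ → T → ℝ, IsSolution 𝔐 r V u₀ Δt u →
            ∀ M₁ : ℝ, M₁ = ∫ x in Ω, u₀ x →
            ∀ p ∈ Set.Icc (1 : ℝ) 2,
              DecaysAtRate (fun n => relEntropy 𝔐 V M₁ p (u n)) Δt (ν p M₁) ∧
              ∀ m M : ℝ, 0 < m →
                (∀ K, m ≤ steadyState 𝔐 V M₁ K ∧ steadyState 𝔐 V M₁ K ≤ M) →
                DecaysAtRate (fun n => relEntropy 𝔐 V M₁ p (u n)) Δt
                  (explicitRate C_LS C_B ζ m M M₁ p) := by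
  obtain ⟨C, hC, hineq⟩ := hΩ.exists_explicitRate_mul_le
  have hvol : volume Ω ≠ ⊤ := hΩ.isBounded.measure_lt_top.ne
  have hA : 0 < volume.real Ω :=
    volume_real_pos_of_isOpen hΩ.isOpen hΩ.connected.nonempty hvol
  refine ⟨C, hC, C, hC, fun V hV ζ hζ => ?_⟩
  obtain ⟨B, hB⟩ := hV.exists_abs_le hΩ.isBounded
  set a := Real.exp (-(2 * B)) / volume.real Ω
  set b := Real.exp (2 * B) / volume.real Ω
  have ha0 : 0 < a := by positivity
  have hb0 : 0 < b := by positivity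
  -- for `p ≠ 1` the bounds of the steady state of unit mass give the rate for every mass
  refine ⟨fun p M₁ => if p = 1 then explicitRate C C ζ (M₁ * a) (M₁ * b) M₁ p
    else explicitRate C C ζ a b 1 p, fun p hp M₁ hM₁ => ?_, fun p hp M₁ M₁' => ?_, ?_⟩
  · dsimp only
    split_ifs
    · exact explicitRate_pos hC hζ (by positivity) (by positivity) hM₁ hp.1
    · exact explicitRate_pos hC hζ ha0 hb0 one_pos hp.1
  · simp only [if_neg hp.1.ne']
  intro T E _ _ 𝔐 hreg r hr u₀ h₀ Δt hΔ u hu M₁ hM₁ p hp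
  have hM₁0 : 0 < M₁ := hM₁ ▸ h₀.mass_pos
  have : Nonempty T := 𝔐.nonempty_cells hΩ.connected.nonempty
  have main : ∀ m M : ℝ, 0 < m →
      (∀ K, m ≤ steadyState 𝔐 V M₁ K ∧ steadyState 𝔐 V M₁ K ≤ M) →
      DecaysAtRate (fun n => relEntropy 𝔐 V M₁ p (u n)) Δt (explicitRate C C ζ m M M₁ p) := by
    intro m M hm hmM
    have K₀ := Classical.arbitrary T
    have hM : 0 < M := hm.trans_le ((hmM K₀).1.trans (hmM K₀).2)
    refine decaysAtRate_of_step (Finset.sum_nonneg fun K _ => ?_) hΔ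
      (explicitRate_pos hC hζ hm hM hM₁0 hp.1) fun n => ?_
    · have hs := steadyState_pos (𝔐 := 𝔐) (V := V) hM₁0 K
      exact mul_nonneg (mul_nonneg (𝔐.area_pos K).le hs.le)
        (Phi_nonneg hp.1 (div_nonneg (hu.nonneg h₀ 0 K) hs.le))
    · have h1 := hu.relEntropy_succ_add_le hr h₀ hΔ hM₁0 hm (fun K => (hmM K).1) hp.1 hp.2 n
      have h2 := hineq T E 𝔐 ζ hζ hreg V M₁ m M p hM₁0 hm hmM hp.1 hp.2 (u (n + 1)) (hu.pos n)
        (by rw [hu.mass hr h₀ hvol hΔ, hM₁])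
      have h3 := mul_le_mul_of_nonneg_left h2 hΔ.le
      linarith
  refine ⟨?_, main⟩
  have h1 := main (M₁ * a) (M₁ * b) (by positivity) fun K => steadyState_mem_Icc 𝔐 hB hM₁0 hA K
  dsimp only
  split_ifs with hp1
  · exact h1
  · have e : explicitRate C C ζ (M₁ * a) (M₁ * b) M₁ p = explicitRate C C ζ a b 1 p := by
      rw [explicitRate, explicitRate, if_neg hp1, if_neg hp1, mul_div_mul_left _ _ hM₁0.ne']
    rwa [← e]
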